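/- **Setting.** Let $d\ge 1$, let $\mathcal O\subseteq\mathbb R^d$ be a possibly unbounded open set for which the divergence theorem holds, and let $\Sigma\subseteq\partial\mathcal O$. Here the divergence theorem holds for $\mathcal O$ if there are a surface measure $\sigma$ on $\partial\mathcal O$, finite on compact sets, and an inward unit normal field $n$ with $\int_{\mathcal O}\operatorname{div}F\,dx=-\int_{\partial\mathcal O}\langle F,n\rangle\,d\sigma$ for every compactly supported vector field $F$ that is continuous on $\bar{\mathcal O}$ and locally Lipschitz on $\mathcal O$ and whose divergence has an integrable positive part (the integral of $\operatorname{div} F$ being then finite). Let $\mathfrak w\in C(\mathcal O)\cap L^1(\mathcal O)$ with $\mathfrak w>0$ on $\mathcal O$, and let $\vartheta$ be continuous on $\bar{\mathcal O}$ (not necessarily bounded) with $\vartheta>0$ on $\mathcal O$ and $\int_{\mathcal O}\vartheta\,\mathfrak w\,dx<\infty$. Let $C_0^\infty(\mathcal O\cup\Sigma)$ be the restrictions to $\mathcal O$ of functions smooth on $\mathbb R^d$ whose restriction to $\mathcal O$ vanishes outside a compact subset of $\mathcal O\cup\Sigma$; for $\Sigma=\partial\mathcal O$ this is $C_0^\infty(\bar{\mathcal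 O})$. Let $H^1(\mathcal O,\mathfrak w)$ be the completion of $C_0^\infty(\bar{\mathcal O})$ in the norm $$\|u\|^2_{H^1(\mathcal O,\mathfrak w)}=\int_{\mathcal O}\big(\vartheta|Du|^2+(1+\vartheta)u^2\big)\mathfrak w\,dx,$$ let $H^1_0(\mathcal O\cup\Sigma,\mathfrak w)$ be the closure of $C_0^\infty(\mathcal O\cup\Sigma)$ in it, and let $(f,v)_{L^2(\mathcal O,\mathfrak w)}=\int_{\mathcal O}fv\,\mathfrak w\,dx$. One says that $u\le 0$ on $\partial\mathcal O\setminus\Sigma$ in the sense of $H^1(\mathcal O,\mathfrak w)$ if $u^+=\max\{u,0\}\in H^1_0(\mathcal O\cup\Sigma,\mathfrak w)$. **Bilinear map.** With summation over repeated indices, let $$\mathfrak a(u,v)=\int_{\mathcal O}\big(a^{ij}u_{x_i}v_{x_j}+d^j u v_{x_j}-b^iu_{x_i}v+cuv\big)\mathfrak w\,dx,\qquad u,v\in H^1(\mathcal O,\mathfrak w),$$ where the coefficients are measurable on $\mathcal O$, $a=(a^{ij})$ is symmetric and nonnegative definite, and for some $K>0$, a.e. on $\mathcal O$ and for all $\eta\in\mathbb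 R^d$, $$\vartheta|\eta|^2\le\langle a\eta,\eta\rangle\le K\vartheta|\eta|^2,\quad |\langle d,\eta\rangle|\le K\vartheta|\eta|,\quad |\langle b,\eta\rangle|\le K\vartheta|\eta|,\quad |c|\le K(1+\vartheta).$$ Assume that $a^{ij},d^j$ are locally Lipschitz on $\mathcal O$ and continuous on $\bar{\mathcal O}$, that $\log\mathfrak w$ is locally Lipschitz on $\mathcal O$, that $\vartheta\mathfrak w$ extends continuously to $\bar{\mathcal O}$ with $\vartheta\mathfrak w=0$ on $\Sigma$, and that $$\int_{\mathcal O}(1+|x|^2)(1+\vartheta^2)\,\mathfrak w\,dx<\infty.$$ Put $$\tilde b^i=b^i+a^{ij}_{x_j}+d^i+(\log\mathfrak w)_{x_j}a^{ij},\qquad \tilde c=c-d^j_{x_j}-(\log\mathfrak w)_{x_j}d^j,$$ and assume that, for some constants $c_0>0$ and $K_1>0$, a.e. on $\mathcal O$, $$\tilde c\ge c_0\qquad\text{and}\qquad \operatorname{tr}a(x)+\langle\tilde b(x),x\rangle\le K_1(1+|x|^2).$$ **Theorem.** 1. Let $f\in L^2(\mathcal O,\mathfrak w)$ with $\operatorname{ess\,sup}_{\mathcal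 O}f<\infty$, and let $u\in H^1(\mathcal O,\mathfrak w)$ satisfy $\operatorname{ess\,sup}_{\mathcal O}u<\infty$, $\mathfrak a(u,v)\le(f,v)_{L^2(\mathcal O,\mathfrak w)}$ for all $v\in H^1_0(\mathcal O\cup\Sigma,\mathfrak w)$ with $v\ge0$ a.e. on $\mathcal O$, and, when $\partial\mathcal O\setminus\Sigma\neq\emptyset$, $u\le0$ on $\partial\mathcal O\setminus\Sigma$ in the sense of $H^1(\mathcal O,\mathfrak w)$. Then $$\operatorname*{ess\,sup}_{\mathcal O}u\le 0\vee\frac1{c_0}\operatorname*{ess\,sup}_{\mathcal O}f .$$ 2. $\mathfrak a$ has the weak maximum principle property on $\mathcal O\cup\Sigma$ for the cone $\{u\in H^1(\mathcal O,\mathfrak w):\operatorname{ess\,sup}_{\mathcal O}u<\infty\}$: if $u$ belongs to this cone, $\mathfrak a(u,v)\le0$ for all $v\in H^1_0(\mathcal O\cup\Sigma,\mathfrak w)$ with $v\ge0$ a.e. on $\mathcal O$, and $u\le0$ on $\partial\mathcal O\setminus\Sigma$ in the sense of $H^1(\mathcal O,\mathfrak w)$, then $u\le0$ a.e. on $\mathcal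 O$. In particular this covers both the case of power weights on subsets of a half-space ($\vartheta\sim x_d^\alpha$, $\mathfrak w\sim x_d^{\beta-1}$, $\beta>0$, $0\le\alpha<2$) and the case of general weights satisfying a weighted Sobolev inequality; neither of these conditions is assumed. -/

import Mathlib

open MeasureTheory Filter Topology
open scoped ContDiff

/-- The Euclidean space `ℝ^d`. -/
abbrev Eu (d : ℕ) : Type := EuclideanSpace ℝ (Fin d)

/-- The partial derivative `∂f/∂x_i` at `x`. -/
noncomputable def pderiv {d : ℕ} (i : Fin d) (f : Eu d → ℝ) (x : Eu d) : ℝ :=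
  fderiv ℝ f x (EuclideanSpace.single i 1)

/-- The divergence `∑ i, ∂F^i/∂x_i` of a vector field. -/
noncomputable def divergence {d : ℕ} (F : Eu d → Eu d) (x : Eu d) : ℝ :=
  ∑ i, pderiv i (fun y => F y i) x

/-- The divergence theorem holds for the open set `O`: there are a surface measure `σ` on `∂O`,
finite on compact sets, and an inward-pointing unit normal field `n` such that
`∫_O div F dx = - ∫_{∂O} ⟨F, n⟩ dσ` for all compactly supported vector fields `F` which are
continuous on the closure of `O` and locally Lipschitz on `O`, as soon as the integral of `div F`
over `O` is defined as an extended real number less than `+∞` (the integral is then finite; the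
case of an integral greater than `-∞` is obtained from `-F`). -/
def DivergenceTheoremHolds {d : ℕ} (O : Set (Eu d)) : Prop :=
  ∃ (σ : Measure (Eu d)) (n : Eu d → Eu d),
    IsFiniteMeasureOnCompacts σ ∧ σ (frontier O)ᶜ = 0 ∧ Measurable n ∧ (∀ᵐ x ∂σ, ‖n x‖ = 1) ∧
    ∀ F : Eu d → Eu d,
      ContinuousOn F (closure O) →
      (∃ C : Set (Eu d), IsCompact C ∧ ∀ x ∈ closure O, x ∉ C → F x = 0) →
      LocallyLipschitzOn O F →
      IntegrableOn (fun x => max (divergence F x) 0) O →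
      IntegrableOn (divergence F) O ∧
        ∫ x in O, divergence F x = - ∫ x, inner ℝ (F x) (n x) ∂σ

/-- `w` is a weight function on `O`: `w ∈ C(O) ∩ L¹(O)` and `w > 0` on `O`. -/
structure IsWeight {d : ℕ} (O : Set (Eu d)) (w : Eu d → ℝ) : Prop where
  continuousOn : ContinuousOn w O
  integrableOn : IntegrableOn w O
  pos : ∀ x ∈ O, 0 < w x

/-- `θ` is a degeneracy coefficient on `O`: it is continuous up to the boundary (possibly unbounded
at infinity) and positive on `O`. -/
structure IsDegeneracyCoefficient {d : ℕ} (O : Set (Eu d)) (θ : Eu d → ℝ) : Prop where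
  continuousOn : ContinuousOn θ (closure O)
  pos : ∀ x ∈ O, 0 < θ x

/-- `g` is a weak gradient of `u` on the open set `O`. -/
structure HasWeakGradient {d : ℕ} (O : Set (Eu d)) (u : Eu d → ℝ) (g : Eu d → Eu d) : Prop where
  locInt : LocallyIntegrableOn u O
  locInt_grad : LocallyIntegrableOn g O
  integral_eq : ∀ φ : Eu d → ℝ, ContDiff ℝ ∞ φ → HasCompactSupport φ → tsupport φ ⊆ O →
    ∀ i, ∫ x in O, u x * pderiv i φ x = - ∫ x in O, g x i * φ x

open Classical in
/-- The weak gradient `Du` of `u` on `O` (unique up to null sets; `0` if there is none). -/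
noncomputable def weakGrad {d : ℕ} (O : Set (Eu d)) (u : Eu d → ℝ) : Eu d → Eu d :=
  if h : ∃ g, HasWeakGradient O u g then h.choose else 0

/-- The square of the norm of `H¹(O, w)`, that is
`∫_O (θ |Du|² + (1 + θ) |u|²) w dx`, as an extended nonnegative number. -/
noncomputable def h1NormSq {d : ℕ} (O : Set (Eu d)) (θ w : Eu d → ℝ) (u : Eu d → ℝ) : ENNReal :=
  ∫⁻ x in O, ENNReal.ofReal
    ((θ x * ‖weakGrad O u x‖ ^ 2 + (1 + θ x) * u x ^ 2) * w x)

/-- `φ` restricted to `O` belongs to `C₀^∞(O ∪ S)`, where `S ⊆ ∂O`: it is smooth up to the boundary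
and its support is a compact subset of `O ∪ S`. For `S = ∂O` this is `C₀^∞` of the closure
of `O`. -/
def IsTestFunction {d : ℕ} (O S : Set (Eu d)) (φ : Eu d → ℝ) : Prop :=
  ContDiff ℝ ∞ φ ∧ ∃ C : Set (Eu d), IsCompact C ∧ C ⊆ O ∪ S ∧ ∀ x ∈ O, x ∉ C → φ x = 0

/-- `u ∈ H¹₀(O ∪ S, w)`: `u` is a measurable function on `O` with a weak gradient and finite
`H¹(O, w)` norm which is the limit, in that norm, of functions in `C₀^∞(O ∪ S)`. -/
structure MemH1Zero {d : ℕ} (O S : Set (Eu d)) (θ w : Eu d → ℝ) (u : Eu d → ℝ) : Prop where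
  aestronglyMeasurable : AEStronglyMeasurable u (volume.restrict O)
  exists_grad : ∃ g, HasWeakGradient O u g
  norm_lt_top : h1NormSq O θ w u < ⊤
  approx : ∃ φ : ℕ → Eu d → ℝ, (∀ n, IsTestFunction O S (φ n)) ∧
    Tendsto (fun n => h1NormSq O θ w (fun x => u x - φ n x)) atTop (𝓝 0)

/-- `u ∈ H¹(O, w)`, the completion of `C₀^∞` of the closure of `O` in the `H¹(O, w)` norm. -/
def MemH1 {d : ℕ} (O : Set (Eu d)) (θ w : Eu d → ℝ) (u : Eu d → ℝ) : Prop :=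
  MemH1Zero O (frontier O) θ w u

/-- `f ∈ L²(O, w)`. -/
def MemL2 {d : ℕ} (O : Set (Eu d)) (w : Eu d → ℝ) (f : Eu d → ℝ) : Prop :=
  AEStronglyMeasurable f (volume.restrict O) ∧ IntegrableOn (fun x => f x ^ 2 * w x) O

/-- The inner product `(f, v)` of `L²(O, w)`. -/
noncomputable def l2Inner {d : ℕ} (O : Set (Eu d)) (w : Eu d → ℝ) (f v : Eu d → ℝ) : ℝ :=
  ∫ x in O, f x * v x * w x

/-- The coefficients `a^{ij}`, `d^j`, `b^i`, `c` of a bilinear form (`d^j` is the field `e`). -/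
structure Coefficients (d : ℕ) where
  a : Eu d → Matrix (Fin d) (Fin d) ℝ
  e : Eu d → Eu d
  b : Eu d → Eu d
  c : Eu d → ℝ

/-- The bilinear form
`𝔞(u,v) = ∫_O (a^{ij} u_{x_i} v_{x_j} + d^j u v_{x_j} - b^i u_{x_i} v + c u v) w dx`. -/
noncomputable def bilinForm {d : ℕ} (A : Coefficients d) (O : Set (Eu d)) (w : Eu d → ℝ)
    (u v : Eu d → ℝ) : ℝ :=
  ∫ x in O,
    ((∑ i, ∑ j, A.a x i j * weakGrad O u x i * weakGrad O v x j)
      + (∑ j, A.e x j * u x * weakGrad O v x j)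
      - (∑ i, A.b x i * weakGrad O u x i * v x)
      + A.c x * u x * v x) * w x

/-- The coefficients are measurable, `a` has values in the nonnegative definite symmetric matrices,
and, a.e. on `O`, `θ|η|² ≤ ⟨aη,η⟩ ≤ Kθ|η|²`, `|⟨d,η⟩| ≤ Kθ|η|`, `|⟨b,η⟩| ≤ Kθ|η|` for all `η`, and
`|c| ≤ K(1+θ)`. -/
structure Coefficients.Bounds {d : ℕ} (A : Coefficients d) (O : Set (Eu d)) (θ : Eu d → ℝ)
    (K : ℝ) : Prop where
  a_meas : ∀ i j, AEMeasurable (fun x => A.a x i j) (volume.restrict O)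
  e_meas : AEMeasurable A.e (volume.restrict O)
  b_meas : AEMeasurable A.b (volume.restrict O)
  c_meas : AEMeasurable A.c (volume.restrict O)
  a_posSemidef : ∀ x ∈ O, (A.a x).PosSemidef
  a_lower : ∀ᵐ x ∂volume.restrict O, ∀ η : Eu d,
    θ x * ‖η‖ ^ 2 ≤ ∑ i, ∑ j, A.a x i j * η i * η j
  a_upper : ∀ᵐ x ∂volume.restrict O, ∀ η : Eu d,
    ∑ i, ∑ j, A.a x i j * η i * η j ≤ K * θ x * ‖η‖ ^ 2
  e_bound : ∀ᵐ x ∂volume.restrict O, ∀ η : Eu d, |inner ℝ (A.e x) η| ≤ K * θ x * ‖η‖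
  b_bound : ∀ᵐ x ∂volume.restrict O, ∀ η : Eu d, |inner ℝ (A.b x) η| ≤ K * θ x * ‖η‖
  c_bound : ∀ᵐ x ∂volume.restrict O, |A.c x| ≤ K * (1 + θ x)

/-- The regularity conditions for integration by parts: `a^{ij}` and `d^j` are locally Lipschitz on
`O` and continuous up to the boundary, `log w` is locally Lipschitz on `O`, and `θ w` has a
continuous extension to the closure of `O` which vanishes on `S`. -/
structure Coefficients.Regular {d : ℕ} (A : Coefficients d) (O S : Set (Eu d))
    (θ w : Eu d → ℝ) : Prop where
  a_lip : ∀ i j, LocallyLipschitzOn O (fun x => A.a x i j)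
  a_cont : ∀ i j, ContinuousOn (fun x => A.a x i j) (closure O)
  e_lip : ∀ j, LocallyLipschitzOn O (fun x => A.e x j)
  e_cont : ∀ j, ContinuousOn (fun x => A.e x j) (closure O)
  log_lip : LocallyLipschitzOn O (fun x => Real.log (w x))
  weight_cont : ∃ ρ : Eu d → ℝ, ContinuousOn ρ (closure O) ∧ (∀ x ∈ O, ρ x = θ x * w x) ∧
    ∀ x ∈ S, ρ x = 0

/-- The first-order coefficient
`b̃^i = b^i + ∑_j ∂a^{ij}/∂x_j + d^i + ∑_j (∂ log w/∂x_j) a^{ij}` of the nondivergence-form operator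
`A u = -a^{ij} u_{x_i x_j} - b̃^i u_{x_i} + c̃ u` associated with the bilinear form. -/
noncomputable def Coefficients.bTilde {d : ℕ} (A : Coefficients d) (w : Eu d → ℝ) (x : Eu d)
    (i : Fin d) : ℝ :=
  A.b x i + (∑ j, pderiv j (fun y => A.a y i j) x) + A.e x i
    + ∑ j, pderiv j (fun y => Real.log (w y)) x * A.a x i j

/-- The zeroth-order coefficient `c̃ = c - ∑_j ∂d^j/∂x_j - ∑_j (∂ log w/∂x_j) d^j` of the same
operator. -/
noncomputable def Coefficients.cTilde {d : ℕ} (A : Coefficients d) (w : Eu d → ℝ) (x : Eu d) : ℝ :=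
  A.c x - (∑ j, pderiv j (fun y => A.e y j) x)
    - ∑ j, pderiv j (fun y => Real.log (w y)) x * A.e x j

/-- The essential supremum of `u` over `O`, as an extended real number. -/
noncomputable def essSupOn {d : ℕ} (O : Set (Eu d)) (u : Eu d → ℝ) : EReal :=
  essSup (fun x => (u x : EReal)) (volume.restrict O)

/-- `u ≤ 0` on `∂O \ S` in the sense of `H¹(O, w)`: `u⁺ ∈ H¹₀(O ∪ S, w)`. -/
def NonposOnBoundary {d : ℕ} (O S : Set (Eu d)) (θ w : Eu d → ℝ) (u : Eu d → ℝ) : Prop :=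
  MemH1Zero O S θ w (fun x => max (u x) 0)

/-- `B(u, v) ≤ (f, v)` for all `v ∈ H¹₀(O ∪ S, w)` with `v ≥ 0` a.e. on `O`. -/
def IsVariationalSubsolution {d : ℕ} (O S : Set (Eu d)) (θ w : Eu d → ℝ)
    (B : (Eu d → ℝ) → (Eu d → ℝ) → ℝ) (f u : Eu d → ℝ) : Prop :=
  ∀ v : Eu d → ℝ, MemH1Zero O S θ w v → (∀ᵐ x ∂volume.restrict O, 0 ≤ v x) →
    B u v ≤ l2Inner O w f v

/-- The bilinear map `B` has the weak maximum principle property on `O ∪ S` for the set `𝔎` of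
functions in `H¹(O, w)`. -/
def WeakMaximumPrincipleProperty {d : ℕ} (O S : Set (Eu d)) (θ w : Eu d → ℝ)
    (B : (Eu d → ℝ) → (Eu d → ℝ) → ℝ) (𝔎 : Set (Eu d → ℝ)) : Prop :=
  ∀ u ∈ 𝔎,
    (∀ v : Eu d → ℝ, MemH1Zero O S θ w v → (∀ᵐ x ∂volume.restrict O, 0 ≤ v x) → B u v ≤ 0) →
    NonposOnBoundary O S θ w u →
    ∀ᵐ x ∂volume.restrict O, u x ≤ 0

/-! The proof compares `u` with a logarithmic barrier and needs neither coercivity of the form nor a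
Sobolev inequality.

Let `L` be the nondivergence operator `nonDivOp`. For smooth `g` and a test function `v`, the flux
`(a Dg + d g) v w` has divergence equal, a.e., to the integrand of `𝔞(g, v)` minus `(L g) v w`. It
vanishes on the whole boundary: on `S` because it is bounded by a multiple of `θ w`, off `S` because
`v` vanishes there. The divergence theorem turns a pointwise bound `κ ≤ L g` into `κ ∫ v w ≤ 𝔞(g,
v)` for nonnegative test functions (`integral_le_of_nonDivOp_ge`), and density extends this to their
energy limits. Taking `g = 1` and a squared test function gives `∫ (2 v d·Dv + c v²) w ≥ 0`;
completing a square with the ellipticity bound then gives `𝔞(v, v) ≥ -K² ∫ θ v² w`.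

Let `F` bound `f`, let `M = 0 ∨ F / c₀`, and let `g = M + k + δ (log (1 + |x|²) + 2 K₁ / c₀)`. The
growth condition gives `L g ≥ c₀ (M + k)`. The truncation `v = (u - g)⁺` is admissible, and `𝔞(u, v)
= 𝔞(g, v) + 𝔞(v, v) ≤ F ∫ v w` yields `c₀ k ∫ v w ≤ K² ∫ θ v² w`. Since `u` is bounded above and `g`
tends to infinity, `v` lives on a bounded set, where `θ ≤ Θ`. If moreover `v ≤ ε` with `K² Θ ε < c₀
k`, then `v = 0` (`le_barrier_of_le_add`).

Hence an excess of at most `(1 + r) k` over the barrier with `k = 0` improves to at most `k`, with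
`r` depending on `δ` but not on `k`. Iteration from the a priori upper bound of `u` shrinks the
excess geometrically to zero, and then `δ → 0`. -/

/-! ### Weighted energies of pairs (function, gradient). -/

section Energy

/-- The classical gradient, as the vector of the partial derivatives. -/
noncomputable def gradVec {d : ℕ} (f : Eu d → ℝ) (x : Eu d) : Eu d :=
  WithLp.toLp 2 fun i => pderiv i f x

/-- The integrand of the squared `H¹(O, w)` norm, with an explicit gradient `g` of `u`. -/
noncomputable def energyDensity {d : ℕ} (θ w : Eu d → ℝ) (u : Eu d → ℝ) (g : Eu d → Eu d)
    (x : Eu d) : ℝ :=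
  (θ x * ‖g x‖ ^ 2 + (1 + θ x) * u x ^ 2) * w x

/-- `u` and `g` are measurable and have finite weighted energy on `O`. -/
structure FiniteEnergy {d : ℕ} (O : Set (Eu d)) (θ w : Eu d → ℝ) (u : Eu d → ℝ)
    (g : Eu d → Eu d) : Prop where
  meas : AEStronglyMeasurable u (volume.restrict O)
  meas_grad : AEStronglyMeasurable g (volume.restrict O)
  integrable : IntegrableOn (energyDensity θ w u g) O

/-- `(u, g)` is a limit, in the energy norm, of `(φ, Dφ)` with `φ ∈ T`. -/
def IsEnergyLimit {d : ℕ} (O : Set (Eu d)) (θ w : Eu d → ℝ) (T : Set (Eu d → ℝ))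
    (u : Eu d → ℝ) (g : Eu d → Eu d) : Prop :=
  ∀ ε > 0, ∃ φ ∈ T, FiniteEnergy O θ w (u - φ) (g - gradVec φ) ∧
    ∫ x in O, energyDensity θ w (u - φ) (g - gradVec φ) x ≤ ε

variable {d : ℕ} {O S : Set (Eu d)} {θ w : Eu d → ℝ}

@[simp] lemma gradVec_apply (f : Eu d → ℝ) (x : Eu d) (i : Fin d) :
    gradVec f x i = pderiv i f x := rfl

/-- The hypothesis has the shape produced by Young's inequality with weight `t` when an
approximation error has energy at most `ε`: let `ε → 0` for fixed `t`, then `t → 0`. It replaces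
Cauchy–Schwarz in all passages to the limit. -/
lemma nonpos_of_forall_le_add {x C p : ℝ}
    (h : ∀ t > 0, ∀ ε > 0, x ≤ C * (t * p + (1 + 1 / t) * ε)) : x ≤ 0 := by
  have h1 : ∀ t > 0, x ≤ C * (t * p) := by
    intro t ht
    have : Tendsto (fun ε : ℝ => C * (t * p + (1 + 1 / t) * ε)) (𝓝[>] 0)
        (𝓝 (C * (t * p + (1 + 1 / t) * 0))) := by
      apply Tendsto.mono_left _ nhdsWithin_le_nhds
      exact Continuous.tendsto (by fun_prop) 0
    rw [mul_zero, add_zero] at this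
    exact ge_of_tendsto this (eventually_mem_nhdsWithin.mono fun ε hε => h t ht ε hε)
  have : Tendsto (fun t : ℝ => C * (t * p)) (𝓝[>] 0) (𝓝 (C * (0 * p))) := by
    apply Tendsto.mono_left _ nhdsWithin_le_nhds
    exact Continuous.tendsto (by fun_prop) 0
  rw [zero_mul, mul_zero] at this
  exact ge_of_tendsto this (eventually_mem_nhdsWithin.mono fun t ht => h1 t ht)

lemma IsWeight.aesm (hw : IsWeight O w) (hO : IsOpen O) :
    AEStronglyMeasurable w (volume.restrict O) :=
  hw.continuousOn.aestronglyMeasurable hO.measurableSet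

lemma IsDegeneracyCoefficient.aesm (hθ : IsDegeneracyCoefficient O θ) (hO : IsOpen O) :
    AEStronglyMeasurable θ (volume.restrict O) :=
  (hθ.continuousOn.mono subset_closure).aestronglyMeasurable hO.measurableSet

lemma energyDensity_nonneg (hw : IsWeight O w) (hθ : IsDegeneracyCoefficient O θ)
    (u : Eu d → ℝ) (g : Eu d → Eu d) {x : Eu d} (hx : x ∈ O) : 0 ≤ energyDensity θ w u g x := by
  have h1 := hw.pos x hx
  have h2 := hθ.pos x hx
  unfold energyDensity
  positivity

lemma aesm_energyDensity (hO : IsOpen O) (hw : IsWeight O w) (hθ : IsDegeneracyCoefficient O θ)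
    {u : Eu d → ℝ} {g : Eu d → Eu d} (hu : AEStronglyMeasurable u (volume.restrict O))
    (hg : AEStronglyMeasurable g (volume.restrict O)) :
    AEStronglyMeasurable (energyDensity θ w u g) (volume.restrict O) := by
  have hw' := hw.aesm hO
  have hθ' := hθ.aesm hO
  exact ((hθ'.mul (hg.norm.pow 2)).add
    ((aestronglyMeasurable_const.add hθ').mul (hu.pow 2))).mul hw'

lemma FiniteEnergy.of_le (hO : IsOpen O) (hw : IsWeight O w) (hθ : IsDegeneracyCoefficient O θ)
    {u : Eu d → ℝ} {g : Eu d → Eu d} (hu : AEStronglyMeasurable u (volume.restrict O))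
    (hg : AEStronglyMeasurable g (volume.restrict O)) {D : Eu d → ℝ} (hD : IntegrableOn D O)
    (h : ∀ x ∈ O, energyDensity θ w u g x ≤ D x) : FiniteEnergy O θ w u g := by
  refine ⟨hu, hg, Integrable.mono' hD (aesm_energyDensity hO hw hθ hu hg) ?_⟩
  filter_upwards [ae_restrict_mem hO.measurableSet] with x hx
  rw [Real.norm_of_nonneg (energyDensity_nonneg hw hθ u g hx)]
  exact h x hx

lemma energyDensity_add_le (hw : IsWeight O w) (hθ : IsDegeneracyCoefficient O θ)
    (u v : Eu d → ℝ) (g k : Eu d → Eu d) {x : Eu d} (hx : x ∈ O) :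
    energyDensity θ w (u + v) (g + k) x
      ≤ 2 * (energyDensity θ w u g x + energyDensity θ w v k x) := by
  have h1 := hw.pos x hx
  have h2 := hθ.pos x hx
  have h3 : ‖g x + k x‖ ^ 2 ≤ 2 * (‖g x‖ ^ 2 + ‖k x‖ ^ 2) := by
    have := norm_add_le (g x) (k x)
    have h0 := norm_nonneg (g x + k x)
    nlinarith [sq_nonneg (‖g x‖ - ‖k x‖)]
  have h4 : (u x + v x) ^ 2 ≤ 2 * (u x ^ 2 + v x ^ 2) := by nlinarith [sq_nonneg (u x - v x)]
  simp only [energyDensity, Pi.add_apply]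
  calc (θ x * ‖g x + k x‖ ^ 2 + (1 + θ x) * (u x + v x) ^ 2) * w x
      ≤ (θ x * (2 * (‖g x‖ ^ 2 + ‖k x‖ ^ 2)) + (1 + θ x) * (2 * (u x ^ 2 + v x ^ 2))) * w x := by
        gcongr
    _ = _ := by ring

lemma FiniteEnergy.add (hO : IsOpen O) (hw : IsWeight O w) (hθ : IsDegeneracyCoefficient O θ)
    {u v : Eu d → ℝ} {g k : Eu d → Eu d} (h : FiniteEnergy O θ w u g)
    (h' : FiniteEnergy O θ w v k) : FiniteEnergy O θ w (u + v) (g + k) :=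
  .of_le hO hw hθ (h.meas.add h'.meas) (h.meas_grad.add h'.meas_grad)
    ((h.integrable.add h'.integrable).const_mul 2)
    fun _ hx => energyDensity_add_le hw hθ u v g k hx

lemma energyDensity_neg (u : Eu d → ℝ) (g : Eu d → Eu d) :
    energyDensity θ w (-u) (-g) = energyDensity θ w u g := by
  ext x; simp [energyDensity]

lemma FiniteEnergy.neg {u : Eu d → ℝ} {g : Eu d → Eu d} (h : FiniteEnergy O θ w u g) :
    FiniteEnergy O θ w (-u) (-g) :=
  ⟨h.meas.neg, h.meas_grad.neg, by rw [energyDensity_neg]; exact h.integrable⟩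

lemma FiniteEnergy.sub (hO : IsOpen O) (hw : IsWeight O w) (hθ : IsDegeneracyCoefficient O θ)
    {u v : Eu d → ℝ} {g k : Eu d → Eu d} (h : FiniteEnergy O θ w u g)
    (h' : FiniteEnergy O θ w v k) : FiniteEnergy O θ w (u - v) (g - k) := by
  rw [sub_eq_add_neg, sub_eq_add_neg]
  exact h.add hO hw hθ h'.neg

lemma FiniteEnergy.integral_add_le (hO : IsOpen O) (hw : IsWeight O w)
    (hθ : IsDegeneracyCoefficient O θ)
    {u v : Eu d → ℝ} {g k : Eu d → Eu d} (h : FiniteEnergy O θ w u g)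
    (h' : FiniteEnergy O θ w v k) :
    ∫ x in O, energyDensity θ w (u + v) (g + k) x ≤
      2 * ((∫ x in O, energyDensity θ w u g x) + ∫ x in O, energyDensity θ w v k x) := by
  rw [← integral_add h.integrable h'.integrable, ← integral_const_mul]
  refine setIntegral_mono_on (h.add hO hw hθ h').integrable
    ((h.integrable.add h'.integrable).const_mul 2) hO.measurableSet ?_
  exact fun _ hx => energyDensity_add_le hw hθ u v g k hx

/-- Limits of energy limits are energy limits. -/
lemma IsEnergyLimit.trans (hO : IsOpen O) (hw : IsWeight O w) (hθ : IsDegeneracyCoefficient O θ)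
    {T : Set (Eu d → ℝ)} {u : Eu d → ℝ} {g : Eu d → Eu d}
    (h : ∀ ε > 0, ∃ v k, IsEnergyLimit O θ w T v k ∧ FiniteEnergy O θ w (u - v) (g - k) ∧
      ∫ x in O, energyDensity θ w (u - v) (g - k) x ≤ ε) : IsEnergyLimit O θ w T u g := by
  intro ε hε
  -- The energy is a squared norm, so adding two errors costs a factor 2, and `2 (ε/4 + ε/4) = ε`.
  obtain ⟨v, k, hvk, h1, h2⟩ := h (ε / 4) (by positivity)
  obtain ⟨φ, hφ, h3, h4⟩ := hvk (ε / 4) (by positivity)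
  have e1 : u - φ = (u - v) + (v - φ) := by abel
  have e2 : g - gradVec φ = (g - k) + (k - gradVec φ) := by abel
  refine ⟨φ, hφ, ?_, ?_⟩
  · rw [e1, e2]; exact h1.add hO hw hθ h3
  · rw [e1, e2]
    have := h1.integral_add_le hO hw hθ h3
    linarith

end Energy

/-! ### Weak gradients, and `H¹₀` as the set of energy limits of test functions. -/

section WeakGradient

variable {d : ℕ} {O S : Set (Eu d)} {θ w : Eu d → ℝ}

lemma integrableOn_mul_of_tsupport_subset (hO : IsOpen O) {f ψ : Eu d → ℝ}
    (hf : LocallyIntegrableOn f O) (hψ : Continuous ψ) (hc : HasCompactSupport ψ)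
    (hs : tsupport ψ ⊆ O) : IntegrableOn (fun x => f x * ψ x) O := by
  have h1 : IntegrableOn f (tsupport ψ) :=
    (locallyIntegrableOn_iff hO.isLocallyClosed).1 hf _ hs hc
  have h2 := h1.mul_continuousOn hψ.continuousOn hc
  refine ((integrableOn_iff_integrable_of_support_subset ?_).1 h2).integrableOn
  exact fun x hx => subset_tsupport ψ (right_ne_zero_of_mul hx)

lemma continuous_pderiv {f : Eu d → ℝ} (hf : ContDiff ℝ ∞ f) (i : Fin d) :
    Continuous (pderiv i f) :=
  (hf.continuous_fderiv (by simp)).clm_apply continuous_const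

lemma continuous_gradVec {f : Eu d → ℝ} (hf : ContDiff ℝ ∞ f) : Continuous (gradVec f) := by
  unfold gradVec
  exact (PiLp.continuous_toLp 2 _).comp (continuous_pi fun i => continuous_pderiv hf i)

lemma tsupport_pderiv_subset (f : Eu d → ℝ) (i : Fin d) : tsupport (pderiv i f) ⊆ tsupport f :=
  tsupport_fderiv_apply_subset ℝ _

lemma hasCompactSupport_pderiv {f : Eu d → ℝ} (hf : HasCompactSupport f) (i : Fin d) :
    HasCompactSupport (pderiv i f) :=
  hf.of_isClosed_subset (isClosed_tsupport _) (tsupport_pderiv_subset f i)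

lemma locallyIntegrableOn_apply {g : Eu d → Eu d} (hO : IsOpen O) (hg : LocallyIntegrableOn g O)
    (i : Fin d) : LocallyIntegrableOn (fun x => g x i) O := by
  rw [locallyIntegrableOn_iff hO.isLocallyClosed] at hg ⊢
  intro k hk hkc
  exact (EuclideanSpace.proj (𝕜 := ℝ) i).integrable_comp (hg k hk hkc)

/-- Weak gradients are unique up to null sets. -/
lemma HasWeakGradient.ae_eq (hO : IsOpen O) {u : Eu d → ℝ} {g k : Eu d → Eu d}
    (hg : HasWeakGradient O u g) (hk : HasWeakGradient O u k) :
    g =ᵐ[volume.restrict O] k := by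
  have key : ∀ i : Fin d, ∀ᵐ x ∂volume, x ∈ O → g x i - k x i = 0 := by
    intro i
    have h1 := locallyIntegrableOn_apply hO hg.locInt_grad i
    have h2 := locallyIntegrableOn_apply hO hk.locInt_grad i
    refine hO.ae_eq_zero_of_integral_contDiff_smul_eq_zero (h1.sub h2) ?_
    intro ψ hψ hψc hψs
    have e1 := hg.integral_eq ψ hψ hψc hψs i
    have e2 := hk.integral_eq ψ hψ hψc hψs i
    have i1 := integrableOn_mul_of_tsupport_subset hO h1 hψ.continuous hψc hψs
    have i2 := integrableOn_mul_of_tsupport_subset hO h2 hψ.continuous hψc hψs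
    rw [← setIntegral_eq_integral_of_forall_compl_eq_zero (s := O)]
    · have : ∀ x, ψ x • (g x i - k x i) = g x i * ψ x - k x i * ψ x := by
        intro x; rw [smul_eq_mul]; ring
      rw [integral_congr_ae (.of_forall this), integral_sub i1 i2]
      linarith
    · intro x hx
      have : ψ x = 0 := image_eq_zero_of_notMem_tsupport fun h => hx (hψs h)
      simp [this]
  have := ae_all_iff.2 key
  rw [EventuallyEq, ae_restrict_iff' hO.measurableSet]
  filter_upwards [this] with x hx hxO
  ext i
  exact sub_eq_zero.1 (hx i hxO)

lemma HasWeakGradient.weakGrad_ae_eq (hO : IsOpen O) {u : Eu d → ℝ} {g : Eu d → Eu d}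
    (hg : HasWeakGradient O u g) : weakGrad O u =ᵐ[volume.restrict O] g := by
  have h : ∃ g, HasWeakGradient O u g := ⟨g, hg⟩
  have : HasWeakGradient O u (weakGrad O u) := by
    rw [weakGrad, dif_pos h]; exact h.choose_spec
  exact this.ae_eq hO hg

lemma HasWeakGradient.sub (hO : IsOpen O) {u v : Eu d → ℝ} {g k : Eu d → Eu d}
    (hu : HasWeakGradient O u g) (hv : HasWeakGradient O v k) :
    HasWeakGradient O (u - v) (g - k) := by
  refine ⟨hu.locInt.sub hv.locInt, hu.locInt_grad.sub hv.locInt_grad, ?_⟩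
  intro ψ hψ hψc hψs i
  have e1 := hu.integral_eq ψ hψ hψc hψs i
  have e2 := hv.integral_eq ψ hψ hψc hψs i
  have hs := (tsupport_pderiv_subset ψ i).trans hψs
  have i1 := integrableOn_mul_of_tsupport_subset hO hu.locInt (continuous_pderiv hψ i)
    (hasCompactSupport_pderiv hψc i) hs
  have i2 := integrableOn_mul_of_tsupport_subset hO hv.locInt (continuous_pderiv hψ i)
    (hasCompactSupport_pderiv hψc i) hs
  have i3 := integrableOn_mul_of_tsupport_subset hO (locallyIntegrableOn_apply hO hu.locInt_grad i)
    hψ.continuous hψc hψs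
  have i4 := integrableOn_mul_of_tsupport_subset hO (locallyIntegrableOn_apply hO hv.locInt_grad i)
    hψ.continuous hψc hψs
  simp only [Pi.sub_apply, PiLp.sub_apply, sub_mul]
  rw [integral_sub i1 i2, integral_sub i3 i4]
  linarith

/-- The gradient of a smooth function is a weak gradient. -/
lemma hasWeakGradient_gradVec {φ : Eu d → ℝ} (hφ : ContDiff ℝ ∞ φ) :
    HasWeakGradient O φ (gradVec φ) := by
  refine ⟨hφ.continuous.locallyIntegrable.locallyIntegrableOn O,
    (continuous_gradVec hφ).locallyIntegrable.locallyIntegrableOn O, ?_⟩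
  intro ψ hψ hψc hψs i
  rw [setIntegral_eq_integral_of_forall_compl_eq_zero,
    setIntegral_eq_integral_of_forall_compl_eq_zero]
  · have h1 : HasCompactSupport fun x => φ x * pderiv i ψ x :=
      (hasCompactSupport_pderiv hψc i).mul_left
    have h2 : HasCompactSupport fun x => pderiv i φ x * ψ x := hψc.mul_left
    have h3 : HasCompactSupport fun x => φ x * ψ x := hψc.mul_left
    exact integral_mul_fderiv_eq_neg_fderiv_mul_of_integrable
      (((continuous_pderiv hφ i).mul hψ.continuous).integrable_of_hasCompactSupport h2)
      ((hφ.continuous.mul (continuous_pderiv hψ i)).integrable_of_hasCompactSupport h1)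
      ((hφ.continuous.mul hψ.continuous).integrable_of_hasCompactSupport h3)
      (fun x _ => hφ.differentiable (by simp) x) (fun x _ => hψ.differentiable (by simp) x)
  · intro x hx
    have : ψ x = 0 := image_eq_zero_of_notMem_tsupport fun h => hx (hψs h)
    simp [this]
  · intro x hx
    have : pderiv i ψ x = 0 :=
      image_eq_zero_of_notMem_tsupport fun h => hx (hψs (tsupport_pderiv_subset ψ i h))
    simp [this]

/-- On compact subsets of `O` the energy controls the unweighted `L²` norms. -/
lemma exists_le_energyDensity (hw : IsWeight O w) (hθ : IsDegeneracyCoefficient O θ)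
    {k : Set (Eu d)} (hk : IsCompact k) (hkO : k ⊆ O) :
    ∃ m > 0, ∀ (u : Eu d → ℝ) (g : Eu d → Eu d), ∀ x ∈ k,
      u x ^ 2 + ‖g x‖ ^ 2 ≤ m * energyDensity θ w u g x := by
  rcases k.eq_empty_or_nonempty with rfl | hne
  · exact ⟨1, one_pos, by simp⟩
  obtain ⟨x0, hx0, h0⟩ := hk.exists_isMinOn hne (hw.continuousOn.mono hkO)
  obtain ⟨x1, hx1, h1⟩ := hk.exists_isMinOn hne
    (((hθ.continuousOn.mono subset_closure).mul hw.continuousOn).mono hkO)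
  have p0 := hw.pos x0 (hkO hx0)
  have p1 : 0 < θ x1 * w x1 := mul_pos (hθ.pos x1 (hkO hx1)) (hw.pos x1 (hkO hx1))
  refine ⟨1 / w x0 + 1 / (θ x1 * w x1), by positivity, ?_⟩
  intro u g x hx
  have q0 : w x0 ≤ w x := h0 hx
  have q1 : θ x1 * w x1 ≤ θ x * w x := h1 hx
  have pw := hw.pos x (hkO hx)
  have pθ := hθ.pos x (hkO hx)
  have a1 : u x ^ 2 ≤ 1 / w x0 * energyDensity θ w u g x := by
    rw [one_div, ← div_eq_inv_mul, le_div_iff₀ p0]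
    unfold energyDensity
    nlinarith [mul_nonneg (sq_nonneg (u x)) (sub_nonneg.2 q0), mul_nonneg (mul_nonneg pθ.le pw.le)
      (sq_nonneg ‖g x‖), mul_nonneg (mul_nonneg pθ.le pw.le) (sq_nonneg (u x))]
  have a2 : ‖g x‖ ^ 2 ≤ 1 / (θ x1 * w x1) * energyDensity θ w u g x := by
    rw [one_div, ← div_eq_inv_mul, le_div_iff₀ p1]
    unfold energyDensity
    nlinarith [mul_nonneg (sq_nonneg ‖g x‖) (sub_nonneg.2 q1), mul_nonneg pw.le
      (sq_nonneg (u x)), mul_nonneg (mul_nonneg pθ.le pw.le) (sq_nonneg (u x))]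
  calc _ ≤ _ := add_le_add a1 a2
    _ = _ := by ring

lemma FiniteEnergy.integrableOn_sq_add (hw : IsWeight O w)
    (hθ : IsDegeneracyCoefficient O θ) {u : Eu d → ℝ} {g : Eu d → Eu d}
    (h : FiniteEnergy O θ w u g) {k : Set (Eu d)} (hk : IsCompact k) (hkO : k ⊆ O) :
    IntegrableOn (fun x => u x ^ 2 + ‖g x‖ ^ 2) k := by
  obtain ⟨m, hm, hle⟩ := exists_le_energyDensity hw hθ hk hkO
  have hr := Measure.restrict_mono hkO (le_refl (volume : Measure (Eu d)))
  refine Integrable.mono' ((h.integrable.mono_set hkO).const_mul m)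
    (((h.meas.mono_measure hr).pow 2).add ((h.meas_grad.mono_measure hr).norm.pow 2)) ?_
  filter_upwards [ae_restrict_mem hk.measurableSet] with x hx
  rw [Real.norm_of_nonneg (by positivity)]
  exact hle u g x hx

lemma FiniteEnergy.locallyIntegrableOn (hO : IsOpen O) (hw : IsWeight O w)
    (hθ : IsDegeneracyCoefficient O θ) {u : Eu d → ℝ} {g : Eu d → Eu d}
    (h : FiniteEnergy O θ w u g) : LocallyIntegrableOn u O ∧ LocallyIntegrableOn g O := by
  rw [locallyIntegrableOn_iff hO.isLocallyClosed, locallyIntegrableOn_iff hO.isLocallyClosed]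
  have key : ∀ k ⊆ O, IsCompact k → IntegrableOn (fun x => 1 + (u x ^ 2 + ‖g x‖ ^ 2)) k :=
    fun k hk hkc => (integrableOn_const hkc.measure_lt_top.ne).add
      (h.integrableOn_sq_add hw hθ hkc hk)
  constructor <;> intro k hk hkc
  · refine Integrable.mono' (key k hk hkc)
      (h.meas.mono_measure (Measure.restrict_mono hk le_rfl)) (.of_forall fun x => ?_)
    rw [Real.norm_eq_abs]
    nlinarith [sq_nonneg (|u x| - 1), sq_abs (u x), sq_nonneg ‖g x‖]
  · refine Integrable.mono' (key k hk hkc)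
      (h.meas_grad.mono_measure (Measure.restrict_mono hk le_rfl)) (.of_forall fun x => ?_)
    nlinarith [sq_nonneg (‖g x‖ - 1), sq_nonneg (u x), sq_nonneg ‖g x‖]

/-- Energy limits of smooth functions have weak gradients. -/
lemma IsEnergyLimit.hasWeakGradient (hO : IsOpen O) (hw : IsWeight O w)
    (hθ : IsDegeneracyCoefficient O θ) {T : Set (Eu d → ℝ)} (hT : ∀ φ ∈ T, ContDiff ℝ ∞ φ)
    {u : Eu d → ℝ} {g : Eu d → Eu d} (hfe : FiniteEnergy O θ w u g)
    (h : IsEnergyLimit O θ w T u g) : HasWeakGradient O u g := by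
  obtain ⟨l1, l2⟩ := hfe.locallyIntegrableOn hO hw hθ
  refine ⟨l1, l2, ?_⟩
  intro ψ hψ hψc hψs i
  have hs := (tsupport_pderiv_subset ψ i).trans hψs
  have hc' := hasCompactSupport_pderiv hψc i
  obtain ⟨m, hm, hle⟩ := exists_le_energyDensity hw hθ hψc hψs
  set N : Eu d → ℝ := fun x => pderiv i ψ x ^ 2 + ψ x ^ 2 with hN
  have hNint : Integrable N := by
    refine Continuous.integrable_of_hasCompactSupport
      (((continuous_pderiv hψ i).pow 2).add (hψ.continuous.pow 2)) ?_
    refine hψc.mono' ?_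
    intro x hx
    by_contra hx'
    apply hx
    have e1 : ψ x = 0 := image_eq_zero_of_notMem_tsupport hx'
    have e2 : pderiv i ψ x = 0 :=
      image_eq_zero_of_notMem_tsupport fun h => hx' (tsupport_pderiv_subset ψ i h)
    simp [hN, e1, e2]
  -- Each approximant `φ` satisfies the identity exactly, so the left side is unchanged when `u` is
  -- replaced by `u - φ`. Young's inequality splits it into `t ∫ N` and `m / t` times the energy of
  -- the error, where `m` compares energy with unweighted squares on the support of `ψ`.
  have main : |(∫ x in O, u x * pderiv i ψ x) + ∫ x in O, g x i * ψ x| ≤ 0 := by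
    refine nonpos_of_forall_le_add (C := 1 + m) (p := ∫ x in O, N x) ?_
    intro t ht ε hε
    obtain ⟨φ, hφ, hf, hi⟩ := h ε hε
    have hφs := hT φ hφ
    have hwg := hasWeakGradient_gradVec (O := O) hφs
    have e := hwg.integral_eq ψ hψ hψc hψs i
    have i1 := integrableOn_mul_of_tsupport_subset hO l1 (continuous_pderiv hψ i) hc' hs
    have i2 := integrableOn_mul_of_tsupport_subset hO hwg.locInt (continuous_pderiv hψ i) hc' hs
    have i3 := integrableOn_mul_of_tsupport_subset hO (locallyIntegrableOn_apply hO l2 i)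
      hψ.continuous hψc hψs
    have i4 := integrableOn_mul_of_tsupport_subset hO
      (locallyIntegrableOn_apply hO hwg.locInt_grad i) hψ.continuous hψc hψs
    have e' : (∫ x in O, u x * pderiv i ψ x) + ∫ x in O, g x i * ψ x =
        ∫ x in O, ((u x * pderiv i ψ x - φ x * pderiv i ψ x) +
          (g x i * ψ x - gradVec φ x i * ψ x)) := by
      have e1 := integral_add (i1.sub i2) (i3.sub i4)
      simp only [Pi.sub_apply] at e1
      rw [e1, integral_sub i1 i2, integral_sub i3 i4]
      linarith
    rw [e']
    have hNint' : IntegrableOn N O := hNint.integrableOn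
    have hNnn : 0 ≤ ∫ x in O, N x := integral_nonneg fun x => by positivity
    calc |∫ x in O, ((u x * pderiv i ψ x - φ x * pderiv i ψ x) +
          (g x i * ψ x - gradVec φ x i * ψ x))|
        ≤ ∫ x in O, (t * N x +
            m * (1 / t) * energyDensity θ w (u - φ) (g - gradVec φ) x) := by
          rw [← Real.norm_eq_abs]
          refine norm_integral_le_of_norm_le
            ((hNint'.const_mul t).add (hf.integrable.const_mul (m * (1 / t)))) ?_
          filter_upwards [ae_restrict_mem hO.measurableSet] with x hx
          by_cases hxs : x ∈ tsupport ψ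
          · have b := hle (u - φ) (g - gradVec φ) x hxs
            simp only [Pi.sub_apply] at b
            have b2 : |g x i - gradVec φ x i| ≤ ‖g x - gradVec φ x‖ :=
              PiLp.norm_apply_le (g x - gradVec φ x) i
            have b3 : (g x i - gradVec φ x i) ^ 2 ≤ ‖g x - gradVec φ x‖ ^ 2 := by
              rw [← sq_abs]; gcongr
            have am : ∀ p q : ℝ, |p * q| ≤ t * q ^ 2 + 1 / t * p ^ 2 := by
              intro p q
              have h0 : 0 ≤ (t * |q| - |p|) ^ 2 / t := by positivity
              have h1 : (t * |q| - |p|) ^ 2 / t = t * q ^ 2 + 1 / t * p ^ 2 - 2 * |p * q| := by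
                rw [abs_mul, ← sq_abs q, ← sq_abs p]; field_simp; ring
              have := abs_nonneg (p * q)
              linarith
            rw [Real.norm_eq_abs, ← sub_mul, ← sub_mul]
            have c1 := am (u x - φ x) (pderiv i ψ x)
            have c2 := am (g x i - gradVec φ x i) (ψ x)
            have c3 := abs_add_le ((u x - φ x) * pderiv i ψ x) ((g x i - gradVec φ x i) * ψ x)
            have c4 : 1 / t * ((u x - φ x) ^ 2 + (g x i - gradVec φ x i) ^ 2) ≤
                1 / t * (m * energyDensity θ w (u - φ) (g - gradVec φ) x) := by
              gcongr; linarith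
            simp only [hN]
            linarith
          · have e1 : ψ x = 0 := image_eq_zero_of_notMem_tsupport hxs
            have e2 : pderiv i ψ x = 0 :=
              image_eq_zero_of_notMem_tsupport fun h => hxs (tsupport_pderiv_subset ψ i h)
            have := energyDensity_nonneg hw hθ (u - φ) (g - gradVec φ) hx
            simp only [e1, e2, hN]
            simp
            positivity
      _ = t * (∫ x in O, N x) + m * (1 / t) *
            ∫ x in O, energyDensity θ w (u - φ) (g - gradVec φ) x := by
          rw [integral_add (hNint'.const_mul t) (hf.integrable.const_mul _), integral_const_mul,
            integral_const_mul]
      _ ≤ t * (∫ x in O, N x) + m * (1 / t) * ε := by gcongr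
      _ ≤ (1 + m) * (t * (∫ x in O, N x) + (1 + 1 / t) * ε) := by
          have : 0 ≤ m * (t * ∫ x in O, N x) := by positivity
          have : 0 ≤ (1 / t) * ε := by positivity
          have : 0 ≤ (m + 1) * ε := by positivity
          nlinarith
  have := abs_eq_zero.1 (le_antisymm main (abs_nonneg _))
  linarith

/-- `weakGrad` is an arbitrary choice; uniqueness up to null sets allows any explicit weak gradient
in its place. -/
lemma h1NormSq_eq (hO : IsOpen O) {u : Eu d → ℝ} {g : Eu d → Eu d}
    (hg : HasWeakGradient O u g) :
    h1NormSq O θ w u = ∫⁻ x in O, ENNReal.ofReal (energyDensity θ w u g x) := by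
  apply lintegral_congr_ae
  filter_upwards [hg.weakGrad_ae_eq hO] with x hx
  rw [energyDensity, hx]

lemma finiteEnergy_of_lintegral_lt_top (hO : IsOpen O) (hw : IsWeight O w)
    (hθ : IsDegeneracyCoefficient O θ) {u : Eu d → ℝ} {g : Eu d → Eu d}
    (hu : AEStronglyMeasurable u (volume.restrict O))
    (hg : AEStronglyMeasurable g (volume.restrict O))
    (h : ∫⁻ x in O, ENNReal.ofReal (energyDensity θ w u g x) < ⊤) : FiniteEnergy O θ w u g := by
  refine ⟨hu, hg, aesm_energyDensity hO hw hθ hu hg, ?_⟩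
  rw [hasFiniteIntegral_iff_ofReal]
  · exact h
  · filter_upwards [ae_restrict_mem hO.measurableSet] with x hx
    exact energyDensity_nonneg hw hθ u g hx

lemma FiniteEnergy.lintegral_eq (hO : IsOpen O) (hw : IsWeight O w)
    (hθ : IsDegeneracyCoefficient O θ) {u : Eu d → ℝ} {g : Eu d → Eu d}
    (h : FiniteEnergy O θ w u g) :
    ∫⁻ x in O, ENNReal.ofReal (energyDensity θ w u g x) =
      ENNReal.ofReal (∫ x in O, energyDensity θ w u g x) := by
  rw [ofReal_integral_eq_lintegral_ofReal h.integrable]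
  filter_upwards [ae_restrict_mem hO.measurableSet] with x hx
  exact energyDensity_nonneg hw hθ u g hx

lemma HasWeakGradient.aesm {u : Eu d → ℝ} {g : Eu d → Eu d}
    (hg : HasWeakGradient O u g) : AEStronglyMeasurable g (volume.restrict O) :=
  hg.locInt_grad.aestronglyMeasurable

lemma MemH1Zero.hasWeakGradient {u : Eu d → ℝ} (h : MemH1Zero O S θ w u) :
    HasWeakGradient O u (weakGrad O u) := by
  rw [weakGrad, dif_pos h.exists_grad]; exact h.exists_grad.choose_spec

lemma MemH1Zero.finiteEnergy (hO : IsOpen O) (hw : IsWeight O w)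
    (hθ : IsDegeneracyCoefficient O θ) {u : Eu d → ℝ} (h : MemH1Zero O S θ w u) :
    FiniteEnergy O θ w u (weakGrad O u) :=
  finiteEnergy_of_lintegral_lt_top hO hw hθ h.aestronglyMeasurable
    (h.hasWeakGradient.aesm) (by rw [← h1NormSq_eq hO h.hasWeakGradient]; exact h.norm_lt_top)

/-- With its converse `IsEnergyLimit.memH1Zero`, this allows limiting arguments to run on pairs with
an explicit gradient and real-valued energies. -/
lemma MemH1Zero.isEnergyLimit (hO : IsOpen O) (hw : IsWeight O w)
    (hθ : IsDegeneracyCoefficient O θ) {u : Eu d → ℝ} (h : MemH1Zero O S θ w u) :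
    IsEnergyLimit O θ w {φ | IsTestFunction O S φ} u (weakGrad O u) := by
  intro ε hε
  obtain ⟨φ, hφ, hlim⟩ := h.approx
  obtain ⟨n, hn⟩ := ((tendsto_order.1 hlim).2 (ENNReal.ofReal ε) (by simpa using hε)).exists
  have hs := (hφ n).1
  have hwg := h.hasWeakGradient.sub hO (hasWeakGradient_gradVec hs)
  change h1NormSq O θ w (u - φ n) < _ at hn
  rw [h1NormSq_eq hO hwg] at hn
  have hf := finiteEnergy_of_lintegral_lt_top hO hw hθ
    (h.aestronglyMeasurable.sub hs.continuous.aestronglyMeasurable)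
    hwg.aesm (hn.trans ENNReal.ofReal_lt_top)
  refine ⟨φ n, hφ n, hf, ?_⟩
  rw [hf.lintegral_eq hO hw hθ, ENNReal.ofReal_lt_ofReal_iff hε] at hn
  exact hn.le

lemma IsEnergyLimit.memH1Zero (hO : IsOpen O) (hw : IsWeight O w)
    (hθ : IsDegeneracyCoefficient O θ) {u : Eu d → ℝ} {g : Eu d → Eu d}
    (hfe : FiniteEnergy O θ w u g)
    (h : IsEnergyLimit O θ w {φ | IsTestFunction O S φ} u g) : MemH1Zero O S θ w u := by
  have hwg := h.hasWeakGradient hO hw hθ (fun φ hφ => hφ.1) hfe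
  refine ⟨hfe.meas, ⟨g, hwg⟩, ?_, ?_⟩
  · rw [h1NormSq_eq hO hwg, hfe.lintegral_eq hO hw hθ]
    exact ENNReal.ofReal_lt_top
  · choose φ hφ hf hi using fun n : ℕ => h (1 / ((n : ℝ) + 1)) (by positivity)
    refine ⟨φ, hφ, ?_⟩
    have e : ∀ n, h1NormSq O θ w (fun x => u x - φ n x) ≤ ENNReal.ofReal (1 / ((n : ℝ) + 1)) := by
      intro n
      change h1NormSq O θ w (u - φ n) ≤ _
      rw [h1NormSq_eq hO (hwg.sub hO (hasWeakGradient_gradVec (hφ n).1)),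
        (hf n).lintegral_eq hO hw hθ]
      exact ENNReal.ofReal_le_ofReal (hi n)
    refine tendsto_of_tendsto_of_tendsto_of_le_of_le tendsto_const_nhds ?_ (fun _ => zero_le) e
    have := ENNReal.tendsto_ofReal (tendsto_one_div_add_atTop_nhds_zero_nat (𝕜 := ℝ))
    simpa using this

end WeakGradient

/-! ### Truncations `(u - g)⁺` as limits of nonnegative test functions. -/

section Truncation

/-- Smooth approximations of the positive part which vanish on the negative half-line. -/
noncomputable def smoothPosPart (n : ℕ) (t : ℝ) : ℝ := t * Real.smoothTransition (n * t)

/-- The profile of the derivatives of `smoothPosPart n`. -/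
noncomputable def smoothPosPartProfile (s : ℝ) : ℝ :=
  Real.smoothTransition s + s * deriv Real.smoothTransition s

lemma contDiff_smoothPosPart (n : ℕ) : ContDiff ℝ ∞ (smoothPosPart n) :=
  contDiff_id.mul (Real.smoothTransition.contDiff.comp (contDiff_const.mul contDiff_id))

lemma hasDerivAt_smoothPosPart (n : ℕ) (t : ℝ) :
    HasDerivAt (smoothPosPart n) (smoothPosPartProfile (n * t)) t := by
  have h1 : HasDerivAt Real.smoothTransition (deriv Real.smoothTransition (n * t)) (n * t) :=
    ((Real.smoothTransition.contDiff (n := 1)).differentiable (by simp) _).hasDerivAt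
  have h2 : HasDerivAt (fun t : ℝ => (n : ℝ) * t) n t := by
    simpa using (hasDerivAt_id t).const_mul (n : ℝ)
  have h3 : HasDerivAt (smoothPosPart n) (1 * Real.smoothTransition (n * t) +
      t * (deriv Real.smoothTransition (n * t) * n)) t := (hasDerivAt_id t).mul (h1.comp t h2)
  rwa [show smoothPosPartProfile (n * t) = 1 * Real.smoothTransition (n * t) +
    t * (deriv Real.smoothTransition (n * t) * n) by unfold smoothPosPartProfile; ring]

lemma continuous_smoothPosPartProfile : Continuous smoothPosPartProfile :=
  Real.smoothTransition.continuous.add (continuous_id.mul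
    ((Real.smoothTransition.contDiff (n := 1)).continuous_deriv (by simp)))

lemma smoothPosPartProfile_of_nonpos {s : ℝ} (hs : s ≤ 0) : smoothPosPartProfile s = 0 := by
  have h0 := Real.smoothTransition.zero_of_nonpos hs
  have : IsLocalMin Real.smoothTransition s :=
    .of_forall fun t => by rw [h0]; exact Real.smoothTransition.nonneg t
  simp [smoothPosPartProfile, h0, this.deriv_eq_zero]

lemma smoothPosPartProfile_of_one_le {s : ℝ} (hs : 1 ≤ s) : smoothPosPartProfile s = 1 := by
  have h0 := Real.smoothTransition.one_of_one_le hs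
  have : IsLocalMax Real.smoothTransition s :=
    .of_forall fun t => by rw [h0]; exact Real.smoothTransition.le_one t
  simp [smoothPosPartProfile, h0, this.deriv_eq_zero]

/-- The derivative of `smoothPosPart n` at `t` is a fixed function of `n t`, continuous and constant
outside `[0, 1]`. One Lipschitz constant therefore serves all `n`, which is what dominated
convergence needs. -/
lemma exists_smoothPosPartProfile_bound : ∃ C : ℝ, 1 ≤ C ∧ ∀ s, |smoothPosPartProfile s| ≤ C := by
  obtain ⟨C, hC⟩ := (isCompact_Icc (a := (0 : ℝ)) (b := 1)).exists_bound_of_continuousOn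
    continuous_smoothPosPartProfile.continuousOn
  refine ⟨max C 1, le_max_right _ _, fun s => ?_⟩
  rcases le_total s 0 with h | h
  · simp [smoothPosPartProfile_of_nonpos h]
  rcases le_total s 1 with h' | h'
  · exact (hC s ⟨h, h'⟩).trans (le_max_left _ _)
  · simp [smoothPosPartProfile_of_one_le h']

lemma smoothPosPart_of_nonpos (n : ℕ) {t : ℝ} (ht : t ≤ 0) : smoothPosPart n t = 0 := by
  rw [smoothPosPart, Real.smoothTransition.zero_of_nonpos, mul_zero]
  exact mul_nonpos_of_nonneg_of_nonpos n.cast_nonneg ht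

lemma smoothPosPart_nonneg (n : ℕ) (t : ℝ) : 0 ≤ smoothPosPart n t := by
  rcases le_total t 0 with h | h
  · rw [smoothPosPart_of_nonpos n h]
  · exact mul_nonneg h (Real.smoothTransition.nonneg _)

lemma smoothPosPart_le (n : ℕ) (t : ℝ) : smoothPosPart n t ≤ max t 0 := by
  rcases le_total t 0 with h | h
  · rw [smoothPosPart_of_nonpos n h]; exact le_max_right _ _
  · exact (mul_le_of_le_one_right h (Real.smoothTransition.le_one _)).trans (le_max_left _ _)

/-- At each `t` the sequences become constant. At `t = 0` the derivatives are all 0, which produces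
the strict inequality in the gradient of the positive part. -/
lemma eventually_smoothPosPart_eq (t : ℝ) :
    ∀ᶠ n : ℕ in atTop, smoothPosPart n t = max t 0 ∧
      smoothPosPartProfile (n * t) = if 0 < t then 1 else 0 := by
  rcases le_or_gt t 0 with h | h
  · refine .of_forall fun n => ⟨?_, ?_⟩
    · rw [smoothPosPart_of_nonpos n h, max_eq_right h]
    · rw [smoothPosPartProfile_of_nonpos (mul_nonpos_of_nonneg_of_nonpos n.cast_nonneg h),
        if_neg h.not_gt]
  · have : Tendsto (fun n : ℕ => (n : ℝ) * t) atTop atTop :=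
      tendsto_natCast_atTop_atTop.atTop_mul_const h
    filter_upwards [this.eventually_ge_atTop 1] with n hn
    rw [smoothPosPart, Real.smoothTransition.one_of_one_le hn, mul_one, max_eq_left h.le,
      smoothPosPartProfile_of_one_le hn, if_pos h]
    exact ⟨rfl, rfl⟩

lemma abs_smoothPosPart_sub_le {C : ℝ} (hC : ∀ s, |smoothPosPartProfile s| ≤ C) (n : ℕ)
    (s t : ℝ) : |smoothPosPart n s - smoothPosPart n t| ≤ C * |s - t| :=
  Convex.norm_image_sub_le_of_norm_hasDerivWithin_le (s := Set.univ)
    (fun x _ => (hasDerivAt_smoothPosPart n x).hasDerivWithinAt) (fun _ _ => hC _)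
    convex_univ (Set.mem_univ t) (Set.mem_univ s)

variable {d : ℕ} {O S : Set (Eu d)} {θ w : Eu d → ℝ}

lemma energyDensity_le_of_le (hw : IsWeight O w) (hθ : IsDegeneracyCoefficient O θ)
    {u v : Eu d → ℝ} {g k : Eu d → Eu d} {C : ℝ} {x : Eu d} (hx : x ∈ O)
    (h1 : |u x| ≤ C * |v x|) (h2 : ‖g x‖ ≤ C * ‖k x‖) :
    energyDensity θ w u g x ≤ C ^ 2 * energyDensity θ w v k x := by
  have p1 := hw.pos x hx
  have p2 := hθ.pos x hx
  have q1 : u x ^ 2 ≤ C ^ 2 * v x ^ 2 := by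
    rw [← sq_abs (u x), ← sq_abs (v x), ← mul_pow]; gcongr
  have q2 : ‖g x‖ ^ 2 ≤ C ^ 2 * ‖k x‖ ^ 2 := by rw [← mul_pow]; gcongr
  calc energyDensity θ w u g x
      ≤ (θ x * (C ^ 2 * ‖k x‖ ^ 2) + (1 + θ x) * (C ^ 2 * v x ^ 2)) * w x := by
        unfold energyDensity; gcongr
    _ = _ := by unfold energyDensity; ring

/-- Dominated convergence for energies. -/
lemma tendsto_integral_energyDensity (hO : IsOpen O) (hw : IsWeight O w)
    (hθ : IsDegeneracyCoefficient O θ) {u : ℕ → Eu d → ℝ} {g : ℕ → Eu d → Eu d}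
    (hu : ∀ n, AEStronglyMeasurable (u n) (volume.restrict O))
    (hg : ∀ n, AEStronglyMeasurable (g n) (volume.restrict O)) {D : Eu d → ℝ}
    (hD : IntegrableOn D O) (hle : ∀ n, ∀ x ∈ O, energyDensity θ w (u n) (g n) x ≤ D x)
    (hlim : ∀ᵐ x ∂volume.restrict O, Tendsto (fun n => u n x) atTop (𝓝 0) ∧
      Tendsto (fun n => g n x) atTop (𝓝 0)) :
    Tendsto (fun n => ∫ x in O, energyDensity θ w (u n) (g n) x) atTop (𝓝 0) := by
  have := tendsto_integral_of_dominated_convergence (μ := volume.restrict O)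
    (F := fun n => energyDensity θ w (u n) (g n)) (f := fun _ => (0 : ℝ)) D
    (fun n => aesm_energyDensity hO hw hθ (hu n) (hg n)) hD ?_ ?_
  · simpa using this
  · intro n
    filter_upwards [ae_restrict_mem hO.measurableSet] with x hx
    rw [Real.norm_of_nonneg (energyDensity_nonneg hw hθ _ _ hx)]
    exact hle n x hx
  · filter_upwards [hlim] with x hx
    have := (((hx.2.norm.pow 2).const_mul (θ x)).add ((hx.1.pow 2).const_mul (1 + θ x))).mul_const
      (w x)
    simpa [energyDensity] using this

lemma gradVec_comp_sub {h h' : ℝ → ℝ} (hh : ∀ t, HasDerivAt h (h' t) t) {φ g : Eu d → ℝ}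
    (hφ : ContDiff ℝ ∞ φ) (hg : ContDiff ℝ ∞ g) :
    gradVec (fun x => h (φ x - g x)) = fun x => h' (φ x - g x) • (gradVec φ x - gradVec g x) := by
  ext x i
  have h1 := (hφ.differentiable (by simp) x).hasFDerivAt.sub
    (hg.differentiable (by simp) x).hasFDerivAt
  have h2 := (hh (φ x - g x)).comp_hasFDerivAt x h1
  have h3 : fderiv ℝ (fun x => h (φ x - g x)) x = _ := h2.fderiv
  simp [pderiv, h3]

/-- A sequence of approximants with almost everywhere convergence. -/
lemma IsEnergyLimit.exists_seq (hO : IsOpen O) (hw : IsWeight O w)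
    (hθ : IsDegeneracyCoefficient O θ) {T : Set (Eu d → ℝ)} {u : Eu d → ℝ} {g : Eu d → Eu d}
    (h : IsEnergyLimit O θ w T u g) :
    ∃ φ : ℕ → Eu d → ℝ, (∀ n, φ n ∈ T) ∧ (∀ n, FiniteEnergy O θ w (u - φ n) (g - gradVec (φ n))) ∧
      Tendsto (fun n => ∫ x in O, energyDensity θ w (u - φ n) (g - gradVec (φ n)) x) atTop (𝓝 0) ∧
      ∀ᵐ x ∂volume.restrict O, Tendsto (fun n => φ n x) atTop (𝓝 (u x)) := by
  choose φ hφ hf hi using fun n : ℕ => h (1 / ((n : ℝ) + 1)) (by positivity)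
  have hnn : ∀ n, 0 ≤ᵐ[volume.restrict O] energyDensity θ w (u - φ n) (g - gradVec (φ n)) := by
    intro n
    filter_upwards [ae_restrict_mem hO.measurableSet] with x hx
    exact energyDensity_nonneg hw hθ _ _ hx
  have hlim : Tendsto (fun n => ∫ x in O, energyDensity θ w (u - φ n) (g - gradVec (φ n)) x)
      atTop (𝓝 0) :=
    squeeze_zero (fun n => integral_nonneg_of_ae (hnn n)) hi
      tendsto_one_div_add_atTop_nhds_zero_nat
  -- The energy densities tend to 0 in `L¹`, hence in measure, hence a.e. along a subsequence;
  -- positivity of `w` then gives pointwise convergence of the functions.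
  have hm : TendstoInMeasure (volume.restrict O)
      (fun n => energyDensity θ w (u - φ n) (g - gradVec (φ n))) atTop (fun _ => (0 : ℝ)) := by
    refine tendstoInMeasure_of_tendsto_eLpNorm (p := 1) one_ne_zero
      (fun n => (hf n).integrable.aestronglyMeasurable) aestronglyMeasurable_const ?_
    have e : ∀ n, eLpNorm (energyDensity θ w (u - φ n) (g - gradVec (φ n)) - fun _ => (0 : ℝ)) 1
        (volume.restrict O) =
        ENNReal.ofReal (∫ x in O, energyDensity θ w (u - φ n) (g - gradVec (φ n)) x) := by
      intro n
      rw [eLpNorm_one_eq_lintegral_enorm, ← (hf n).lintegral_eq hO hw hθ]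
      apply lintegral_congr_ae
      filter_upwards [hnn n] with x hx
      simp only [Pi.sub_apply, sub_zero]
      exact Real.enorm_eq_ofReal hx
    simp only [e]
    simpa using ENNReal.tendsto_ofReal hlim
  obtain ⟨ns, hns, hae⟩ := hm.exists_seq_tendsto_ae
  refine ⟨fun n => φ (ns n), fun n => hφ _, fun n => hf _, hlim.comp hns.tendsto_atTop, ?_⟩
  filter_upwards [hae, ae_restrict_mem hO.measurableSet] with x hx hxO
  have p1 := hw.pos x hxO
  have p2 := hθ.pos x hxO
  have h2 : Tendsto (fun n => (u x - φ (ns n) x) ^ 2) atTop (𝓝 0) := by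
    refine squeeze_zero (fun n => sq_nonneg _) (fun n => ?_)
      (by simpa using hx.const_mul (1 / w x))
    rw [← div_eq_inv_mul, le_div_iff₀ p1]
    simp only [energyDensity, Pi.sub_apply]
    gcongr
    have : 0 ≤ θ x * ‖g x - gradVec (φ (ns n)) x‖ ^ 2 := by positivity
    have : 0 ≤ θ x * (u x - φ (ns n) x) ^ 2 := by positivity
    linarith
  have h3 : Tendsto (fun n => u x - φ (ns n) x) atTop (𝓝 0) := by
    rw [tendsto_zero_iff_abs_tendsto_zero]
    have := h2.sqrt
    simpa [Real.sqrt_sq_eq_abs, Function.comp_def] using this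
  simpa using h3.const_sub (u x)

/-- Nonnegative test functions. -/
def nonnegTest {d : ℕ} (O S : Set (Eu d)) : Set (Eu d → ℝ) :=
  {φ | IsTestFunction O S φ ∧ ∀ x, 0 ≤ φ x}

lemma finiteEnergy_smoothPosPart (hO : IsOpen O) (hw : IsWeight O w)
    (hθ : IsDegeneracyCoefficient O θ) {u : Eu d → ℝ} {G : Eu d → Eu d}
    (hfe : FiniteEnergy O θ w u G) (n : ℕ) :
    FiniteEnergy O θ w (fun x => smoothPosPart n (u x))
      (fun x => smoothPosPartProfile (n * u x) • G x) := by
  obtain ⟨C, hC1, hC⟩ := exists_smoothPosPartProfile_bound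
  refine .of_le hO hw hθ
    ((contDiff_smoothPosPart n).continuous.comp_aestronglyMeasurable hfe.meas)
    ((continuous_smoothPosPartProfile.comp_aestronglyMeasurable (hfe.meas.const_mul _)).smul
      hfe.meas_grad) (hfe.integrable.const_mul (C ^ 2)) fun x hx => ?_
  refine energyDensity_le_of_le hw hθ hx ?_ ?_
  · have := abs_smoothPosPart_sub_le hC n (u x) 0
    simpa [smoothPosPart_of_nonpos n le_rfl] using this
  · rw [norm_smul]
    exact mul_le_mul_of_nonneg_right (hC _) (norm_nonneg _)

/-- Applying `smoothPosPart n` to `φ m - g` yields a nonnegative test function: where `φ m` vanishes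
the argument is `-g ≤ 0`, so the support does not grow. The gradient error splits in two. In `s'` a
bounded profile multiplies the error of `φ m`, which is small in energy; in `r` a difference of
profiles multiplies a fixed gradient, which is small by a.e. and dominated convergence. -/
lemma IsEnergyLimit.smoothPosPart_sub (hO : IsOpen O) (hw : IsWeight O w)
    (hθ : IsDegeneracyCoefficient O θ) {u g : Eu d → ℝ} {G : Eu d → Eu d}
    (hfe : FiniteEnergy O θ w u G)
    (h : IsEnergyLimit O θ w {φ | IsTestFunction O S φ} u G) (hg : ContDiff ℝ ∞ g)
    (hg0 : ∀ x, 0 ≤ g x) (hgfe : FiniteEnergy O θ w g (gradVec g)) (n : ℕ) :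
    IsEnergyLimit O θ w (nonnegTest O S) (fun x => smoothPosPart n (u x - g x))
      (fun x => smoothPosPartProfile (n * (u x - g x)) • (G x - gradVec g x)) := by
  obtain ⟨C, hC1, hC⟩ := exists_smoothPosPartProfile_bound
  obtain ⟨φ, hφ, hf, hlim, hae⟩ := h.exists_seq hO hw hθ
  have hug := hfe.sub hO hw hθ hgfe
  set ψ := smoothPosPartProfile with hψ
  set r : ℕ → Eu d → Eu d := fun m x =>
    (ψ (n * (u x - g x)) - ψ (n * (φ m x - g x))) • (G x - gradVec g x) with hr
  set s : ℕ → Eu d → ℝ := fun m x => smoothPosPart n (u x - g x) - smoothPosPart n (φ m x - g x)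
    with hs
  set s' : ℕ → Eu d → Eu d := fun m x => ψ (n * (φ m x - g x)) • (G x - gradVec (φ m) x) with hs'
  have mψu : AEStronglyMeasurable (fun x => ψ (n * (u x - g x))) (volume.restrict O) :=
    continuous_smoothPosPartProfile.comp_aestronglyMeasurable
      ((hfe.meas.sub hg.continuous.aestronglyMeasurable).const_mul _)
  have mψφ : ∀ m, AEStronglyMeasurable (fun x => ψ (n * (φ m x - g x))) (volume.restrict O) :=
    fun m => (continuous_smoothPosPartProfile.comp
      (continuous_const.mul ((hφ m).1.continuous.sub hg.continuous))).aestronglyMeasurable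
  have mr : ∀ m, AEStronglyMeasurable (r m) (volume.restrict O) := fun m =>
    (mψu.sub (mψφ m)).smul hug.meas_grad
  have rle : ∀ m, ∀ x ∈ O, energyDensity θ w (0 : Eu d → ℝ) (r m) x
      ≤ (2 * C) ^ 2 * energyDensity θ w (u - g) (G - gradVec g) x := by
    intro m x hx
    refine energyDensity_le_of_le hw hθ hx ?_ ?_
    · simp only [Pi.zero_apply, abs_zero]; positivity
    · simp only [hr, norm_smul]
      refine mul_le_mul_of_nonneg_right ?_ (norm_nonneg _)
      have := norm_sub_le (ψ (n * (u x - g x))) (ψ (n * (φ m x - g x)))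
      have h1 := hC (n * (u x - g x))
      have h2 := hC (n * (φ m x - g x))
      simp only [Real.norm_eq_abs] at this ⊢
      linarith
  have rfe : ∀ m, FiniteEnergy O θ w (0 : Eu d → ℝ) (r m) := fun m =>
    .of_le hO hw hθ aestronglyMeasurable_const (mr m)
      (hug.integrable.const_mul ((2 * C) ^ 2)) (rle m)
  have rlim : Tendsto (fun m => ∫ x in O, energyDensity θ w (0 : Eu d → ℝ) (r m) x) atTop
      (𝓝 0) := by
    refine tendsto_integral_energyDensity hO hw hθ (u := fun _ => 0)
      (fun _ => aestronglyMeasurable_const) mr (hug.integrable.const_mul ((2 * C) ^ 2)) rle ?_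
    filter_upwards [hae] with x hx
    refine ⟨tendsto_const_nhds, ?_⟩
    have h1 : Tendsto (fun m => ψ (n * (φ m x - g x))) atTop (𝓝 (ψ (n * (u x - g x)))) :=
      (continuous_smoothPosPartProfile.tendsto _).comp ((hx.sub_const (g x)).const_mul _)
    have h2 := (h1.const_sub (ψ (n * (u x - g x)))).smul_const (G x - gradVec g x)
    simpa [hr] using h2
  have sle : ∀ m, ∀ x ∈ O, energyDensity θ w (s m) (s' m) x
      ≤ C ^ 2 * energyDensity θ w (u - φ m) (G - gradVec (φ m)) x := by
    intro m x hx
    refine energyDensity_le_of_le hw hθ hx ?_ ?_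
    · have := abs_smoothPosPart_sub_le hC n (u x - g x) (φ m x - g x)
      rwa [sub_sub_sub_cancel_right] at this
    · simp only [hs', norm_smul]
      exact mul_le_mul_of_nonneg_right (hC _) (norm_nonneg _)
  have sfe : ∀ m, FiniteEnergy O θ w (s m) (s' m) := fun m =>
    .of_le hO hw hθ
      ((finiteEnergy_smoothPosPart hO hw hθ hug n).meas.sub
        ((contDiff_smoothPosPart n).continuous.comp
          ((hφ m).1.continuous.sub hg.continuous)).aestronglyMeasurable)
      ((mψφ m).smul (hf m).meas_grad) ((hf m).integrable.const_mul (C ^ 2)) (sle m)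
  have slim : Tendsto (fun m => 2 * (C ^ 2 * (∫ x in O, energyDensity θ w (u - φ m)
      (G - gradVec (φ m)) x) + ∫ x in O, energyDensity θ w (0 : Eu d → ℝ) (r m) x)) atTop
      (𝓝 0) := by
    simpa using ((hlim.const_mul (C ^ 2)).add rlim).const_mul 2
  intro ε hε
  obtain ⟨m, hm⟩ := ((tendsto_order.1 slim).2 ε hε).exists
  have hgr := gradVec_comp_sub (hasDerivAt_smoothPosPart n) (hφ m).1 hg
  have e1 : ((fun x => smoothPosPart n (u x - g x)) - fun x => smoothPosPart n (φ m x - g x)) =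
      s m + 0 := by rw [add_zero]; rfl
  have e2 : (fun x => ψ (n * (u x - g x)) • (G x - gradVec g x)) -
      gradVec (fun x => smoothPosPart n (φ m x - g x)) = s' m + r m := by
    rw [hgr]
    ext1 x
    simp only [Pi.sub_apply, Pi.add_apply, hs', hr, ← hψ]
    module
  refine ⟨fun x => smoothPosPart n (φ m x - g x), ⟨⟨?_, ?_⟩, fun x => smoothPosPart_nonneg _ _⟩,
    ?_, ?_⟩
  · exact (contDiff_smoothPosPart n).comp ((hφ m).1.sub hg)
  · obtain ⟨K, hK, hKO, h0⟩ := (hφ m).2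
    refine ⟨K, hK, hKO, fun x hx hxK => ?_⟩
    simp only [h0 x hx hxK, zero_sub]
    exact smoothPosPart_of_nonpos n (neg_nonpos.2 (hg0 x))
  · rw [e1, e2]; exact (sfe m).add hO hw hθ (rfe m)
  · rw [e1, e2]
    have h1 := (sfe m).integral_add_le hO hw hθ (rfe m)
    have h2 : ∫ x in O, energyDensity θ w (s m) (s' m) x ≤
        C ^ 2 * ∫ x in O, energyDensity θ w (u - φ m) (G - gradVec (φ m)) x := by
      rw [← integral_const_mul]
      exact setIntegral_mono_on (sfe m).integrable ((hf m).integrable.const_mul _)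
        hO.measurableSet (sle m)
    linarith

/-- Truncation below a smooth nonnegative function: `(u - g)⁺` is an energy limit of nonnegative
test functions, with gradient `1_{u > g} (Du - Dg)`. -/
lemma IsEnergyLimit.posPart_sub (hO : IsOpen O) (hw : IsWeight O w)
    (hθ : IsDegeneracyCoefficient O θ) {u g : Eu d → ℝ} {G : Eu d → Eu d}
    (hfe : FiniteEnergy O θ w u G)
    (h : IsEnergyLimit O θ w {φ | IsTestFunction O S φ} u G) (hg : ContDiff ℝ ∞ g)
    (hg0 : ∀ x, 0 ≤ g x) (hgfe : FiniteEnergy O θ w g (gradVec g)) :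
    FiniteEnergy O θ w (fun x => max (u x - g x) 0)
      (fun x => if g x < u x then G x - gradVec g x else 0) ∧
    IsEnergyLimit O θ w (nonnegTest O S) (fun x => max (u x - g x) 0)
      (fun x => if g x < u x then G x - gradVec g x else 0) := by
  obtain ⟨C, hC1, hC⟩ := exists_smoothPosPartProfile_bound
  have hug := hfe.sub hO hw hθ hgfe
  set V : Eu d → ℝ := fun x => max (u x - g x) 0 with hV
  set V' : Eu d → Eu d := fun x => if g x < u x then G x - gradVec g x else 0 with hV'
  have sfe := finiteEnergy_smoothPosPart hO hw hθ hug
  have mV : AEStronglyMeasurable V (volume.restrict O) :=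
    hug.meas.sup aestronglyMeasurable_const
  have ev : ∀ x, ∀ᶠ n : ℕ in atTop, smoothPosPart n (u x - g x) = V x ∧
      smoothPosPartProfile (n * (u x - g x)) • (G x - gradVec g x) = V' x := by
    intro x
    filter_upwards [eventually_smoothPosPart_eq (u x - g x)] with n hn
    refine ⟨hn.1, ?_⟩
    rw [hn.2]
    simp only [sub_pos, hV']
    split_ifs <;> simp
  have mV' : AEStronglyMeasurable V' (volume.restrict O) :=
    aestronglyMeasurable_of_tendsto_ae atTop (fun n => (sfe n).meas_grad)
      (.of_forall fun x => tendsto_const_nhds.congr' ((ev x).mono fun n hn => hn.2.symm))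
  have vfe : FiniteEnergy O θ w V V' := by
    refine .of_le hO hw hθ mV mV' (hug.integrable.const_mul (1 ^ 2)) fun x hx => ?_
    refine energyDensity_le_of_le hw hθ hx ?_ ?_
    · simp only [hV, one_mul, Pi.sub_apply]
      rw [abs_of_nonneg (le_max_right _ _)]
      exact max_le (le_abs_self _) (abs_nonneg _)
    · simp only [hV', one_mul]
      split_ifs
      · rfl
      · simp
  -- The smooth truncations are energy limits already, so it remains to send `n → ∞` and close up.
  refine ⟨vfe, IsEnergyLimit.trans hO hw hθ fun ε hε => ?_⟩
  have lim := tendsto_integral_energyDensity hO hw hθ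
    (u := fun n => V - fun x => smoothPosPart n (u x - g x))
    (g := fun n => V' - fun x => smoothPosPartProfile (n * (u x - g x)) • (G x - gradVec g x))
    (fun n => mV.sub (sfe n).meas) (fun n => mV'.sub (sfe n).meas_grad)
    (hug.integrable.const_mul ((1 + C) ^ 2)) ?_ ?_
  · obtain ⟨n, hn⟩ := ((tendsto_order.1 lim).2 ε hε).exists
    exact ⟨_, _, h.smoothPosPart_sub hO hw hθ hfe hg hg0 hgfe n, vfe.sub hO hw hθ (sfe n), hn.le⟩
  · intro n x hx
    refine energyDensity_le_of_le hw hθ hx ?_ ?_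
    · simp only [Pi.sub_apply]
      have h1 := smoothPosPart_le n (u x - g x)
      have h2 := smoothPosPart_nonneg n (u x - g x)
      have h3 : V x ≤ |u x - g x| := max_le (le_abs_self _) (abs_nonneg _)
      rw [abs_of_nonneg (sub_nonneg.2 h1)]
      nlinarith [abs_nonneg (u x - g x)]
    · simp only [Pi.sub_apply]
      refine (norm_sub_le _ _).trans ?_
      rw [add_mul, norm_smul]
      refine add_le_add ?_ (mul_le_mul_of_nonneg_right (hC _) (norm_nonneg _))
      simp only [hV', one_mul]
      split_ifs
      · rfl
      · simp
  · refine .of_forall fun x => ⟨?_, ?_⟩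
    · exact tendsto_const_nhds.congr' ((ev x).mono fun n hn => by simp [hn.1])
    · exact tendsto_const_nhds.congr' ((ev x).mono fun n hn => by simp [hn.2])

lemma IsEnergyLimit.mono {T T' : Set (Eu d → ℝ)} {u : Eu d → ℝ} {g : Eu d → Eu d}
    (h : IsEnergyLimit O θ w T u g) (hT : T ⊆ T') : IsEnergyLimit O θ w T' u g :=
  fun ε hε => let ⟨φ, hφ, h'⟩ := h ε hε; ⟨φ, hT hφ, h'⟩

end Truncation

/-! ### Boundedness of the bilinear form in the energy norm. -/

section FormBounds

variable {d : ℕ} {O S : Set (Eu d)} {θ w : Eu d → ℝ} {A : Coefficients d} {K : ℝ}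

/-- The integrand of the bilinear form, with explicit gradients `ξ` of `u` and `η` of `v`. -/
noncomputable def formDensity {d : ℕ} (A : Coefficients d) (w : Eu d → ℝ) (u : Eu d → ℝ)
    (ξ : Eu d → Eu d) (v : Eu d → ℝ) (η : Eu d → Eu d) (x : Eu d) : ℝ :=
  ((∑ i, ∑ j, A.a x i j * ξ x i * η x j) + (∑ j, A.e x j * u x * η x j)
    - (∑ i, A.b x i * ξ x i * v x) + A.c x * u x * v x) * w x

/-- The symmetric bilinear integrand associated with the quadratic form
`(2 v d^j v_{x_j} + c v²) w`. -/
noncomputable def lowerDensity {d : ℕ} (A : Coefficients d) (w : Eu d → ℝ) (u : Eu d → ℝ)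
    (ξ : Eu d → Eu d) (v : Eu d → ℝ) (η : Eu d → Eu d) (x : Eu d) : ℝ :=
  ((∑ j, A.e x j * u x * η x j) + (∑ j, A.e x j * v x * ξ x j) + A.c x * u x * v x) * w x

lemma sum_mul_eq_inner (p q : Eu d) : ∑ j, p j * q j = inner ℝ p q := by
  simp [PiLp.inner_apply, mul_comm]

lemma sum_mul_mul_eq (p q : Eu d) (r : ℝ) : ∑ j, p j * r * q j = r * inner ℝ p q := by
  rw [← sum_mul_eq_inner, Finset.mul_sum]
  exact Finset.sum_congr rfl fun _ _ => by ring

lemma sum_mul_mul_eq' (p q : Eu d) (r : ℝ) : ∑ j, p j * q j * r = r * inner ℝ p q := by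
  rw [← sum_mul_eq_inner, Finset.mul_sum]
  exact Finset.sum_congr rfl fun _ _ => by ring

/-- Cauchy's inequality for a nonnegative symmetric bilinear form. -/
lemma abs_sum_mul_mul_le {M : Matrix (Fin d) (Fin d) ℝ} (hM : ∀ i j, M i j = M j i)
    (h0 : ∀ η : Eu d, 0 ≤ ∑ i, ∑ j, M i j * η i * η j) (ξ η : Eu d) {t : ℝ} (ht : 0 < t) :
    |∑ i, ∑ j, M i j * ξ i * η j| ≤
      (t * (∑ i, ∑ j, M i j * ξ i * ξ j) + 1 / t * ∑ i, ∑ j, M i j * η i * η j) / 2 := by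
  have hs : ∑ i, ∑ j, M i j * η i * ξ j = ∑ i, ∑ j, M i j * ξ i * η j := by
    rw [Finset.sum_comm]
    refine Finset.sum_congr rfl fun i _ => Finset.sum_congr rfl fun j _ => ?_
    rw [hM]; ring
  have key : ∀ r : ℝ, ∑ i, ∑ j, M i j * (t • ξ + r • η) i * (t • ξ + r • η) j =
      t ^ 2 * (∑ i, ∑ j, M i j * ξ i * ξ j) + 2 * t * r * (∑ i, ∑ j, M i j * ξ i * η j) +
      r ^ 2 * ∑ i, ∑ j, M i j * η i * η j := by
    intro r
    have e : 2 * t * r * (∑ i, ∑ j, M i j * ξ i * η j) =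
        t * r * (∑ i, ∑ j, M i j * ξ i * η j) + t * r * ∑ i, ∑ j, M i j * η i * ξ j := by
      rw [hs]; ring
    rw [e]
    simp only [Finset.mul_sum, ← Finset.sum_add_distrib]
    refine Finset.sum_congr rfl fun i _ => Finset.sum_congr rfl fun j _ => ?_
    simp only [PiLp.add_apply, PiLp.smul_apply, smul_eq_mul]
    ring
  -- Nonnegativity at `t ξ ± η` reads `2 t |b| ≤ t² p + q`.
  have h1 := h0 (t • ξ + (1 : ℝ) • η)
  have h2 := h0 (t • ξ + (-1 : ℝ) • η)
  rw [key] at h1 h2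
  set p := ∑ i, ∑ j, M i j * ξ i * ξ j
  set q := ∑ i, ∑ j, M i j * η i * η j
  set b := ∑ i, ∑ j, M i j * ξ i * η j
  have e : (t * p + 1 / t * q) / 2 = (t ^ 2 * p + q) / (2 * t) := by field_simp
  rw [e, le_div_iff₀ (by positivity), ← abs_of_pos (show 0 < 2 * t by positivity), ← abs_mul,
    abs_le]
  constructor <;> nlinarith

lemma mul_le_weighted {t : ℝ} (ht : 0 < t) (p q : ℝ) :
    p * q ≤ (t * p ^ 2 + 1 / t * q ^ 2) / 2 := by
  have h : (t * p ^ 2 + 1 / t * q ^ 2) / 2 - p * q = (t * p - q) ^ 2 / (2 * t) := by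
    field_simp; ring
  have : 0 ≤ (t * p - q) ^ 2 / (2 * t) := by positivity
  linarith

lemma Coefficients.Bounds.a_symm (hA : A.Bounds O θ K) {x : Eu d} (hx : x ∈ O) (i j : Fin d) :
    A.a x i j = A.a x j i := by
  have := (hA.a_posSemidef x hx).isHermitian.apply i j
  simpa using this.symm

/-- The pointwise bound for the integrand of the bilinear form. -/
lemma Coefficients.Bounds.abs_formDensity_le (hO : IsOpen O) (hw : IsWeight O w)
    (hθ : IsDegeneracyCoefficient O θ) (hK : 0 < K) (hA : A.Bounds O θ K) :
    ∀ᵐ x ∂volume.restrict O, ∀ (u : Eu d → ℝ) (ξ : Eu d → Eu d) (v : Eu d → ℝ) (η : Eu d → Eu d)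
      (t : ℝ), 0 < t → |formDensity A w u ξ v η x| ≤
        K * (t * energyDensity θ w u ξ x + 1 / t * energyDensity θ w v η x) ∧
      |lowerDensity A w u ξ v η x| ≤
        K * (t * energyDensity θ w u ξ x + 1 / t * energyDensity θ w v η x) := by
  filter_upwards [ae_restrict_mem hO.measurableSet, hA.a_lower, hA.a_upper, hA.e_bound, hA.b_bound,
    hA.c_bound] with x hx h1 h2 h3 h4 h5 u ξ v η t ht
  have pw := hw.pos x hx
  have pθ := hθ.pos x hx
  have ht' : 0 < 1 / t := by positivity
  have a0 : ∀ η : Eu d, 0 ≤ ∑ i, ∑ j, A.a x i j * η i * η j := fun η =>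
    le_trans (by positivity) (h1 η)
  have ba := abs_sum_mul_mul_le (hA.a_symm hx) a0 (ξ x) (η x) ht
  have ba1 := mul_le_mul_of_nonneg_left (h2 (ξ x)) ht.le
  have ba2 := mul_le_mul_of_nonneg_left (h2 (η x)) ht'.le
  have be : ∀ (p : ℝ) (ζ : Eu d), |p * inner ℝ (A.e x) ζ| ≤ K * θ x * (|p| * ‖ζ‖) := by
    intro p ζ
    rw [abs_mul]
    calc |p| * |inner ℝ (A.e x) ζ| ≤ |p| * (K * θ x * ‖ζ‖) := by gcongr; exact h3 ζ
      _ = _ := by ring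
  have bb : |v x * inner ℝ (A.b x) (ξ x)| ≤ K * θ x * (‖ξ x‖ * |v x|) := by
    rw [abs_mul]
    calc |v x| * |inner ℝ (A.b x) (ξ x)| ≤ |v x| * (K * θ x * ‖ξ x‖) := by gcongr; exact h4 _
      _ = _ := by ring
  have bc : |A.c x * u x * v x| ≤ K * (1 + θ x) * (|u x| * |v x|) := by
    rw [abs_mul, abs_mul, mul_assoc]; gcongr
  -- In either integrand each of `ξ`, `η`, `u`, `v` enters at most two terms, each with the factor
  -- 1/2 of Young's inequality, so the total constant is `K` itself.
  have q1 := mul_le_weighted ht |u x| ‖η x‖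
  have q2 := mul_le_weighted ht ‖ξ x‖ |v x|
  have q3 := mul_le_weighted ht |u x| |v x|
  rw [sq_abs] at q1 q2 q3
  rw [sq_abs] at q3
  have kθ : 0 ≤ K * θ x := by positivity
  have kθ1 : 0 ≤ K * (1 + θ x) := by positivity
  have r1 := mul_le_mul_of_nonneg_left q1 kθ
  have r2 := mul_le_mul_of_nonneg_left q2 kθ
  have r3 := mul_le_mul_of_nonneg_left q3 kθ1
  have z1 : 0 ≤ K * (t * u x ^ 2) := by positivity
  have z2 : 0 ≤ K * (1 / t * v x ^ 2) := by positivity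
  have z3 : 0 ≤ K * θ x * (t * ‖ξ x‖ ^ 2) := by positivity
  have z4 : 0 ≤ K * θ x * (1 / t * ‖η x‖ ^ 2) := by positivity
  obtain ⟨ba3, ba4⟩ := abs_le.1 ba
  obtain ⟨be1, be1'⟩ := abs_le.1 (be (u x) (η x))
  obtain ⟨be2, be2'⟩ := abs_le.1 (be (v x) (ξ x))
  obtain ⟨bb1, bb2⟩ := abs_le.1 bb
  obtain ⟨bc1, bc2⟩ := abs_le.1 bc
  constructor
  · rw [formDensity, sum_mul_mul_eq, sum_mul_mul_eq', abs_mul, abs_of_pos pw]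
    have e : K * (t * energyDensity θ w u ξ x + 1 / t * energyDensity θ w v η x) =
      K * (t * (θ x * ‖ξ x‖ ^ 2 + (1 + θ x) * u x ^ 2) +
        1 / t * (θ x * ‖η x‖ ^ 2 + (1 + θ x) * v x ^ 2)) * w x := by
      unfold energyDensity; ring
    rw [e]
    refine mul_le_mul_of_nonneg_right ?_ pw.le
    rw [abs_le]
    constructor <;> linarith
  · rw [lowerDensity, sum_mul_mul_eq, sum_mul_mul_eq, abs_mul, abs_of_pos pw]
    have e : K * (t * energyDensity θ w u ξ x + 1 / t * energyDensity θ w v η x) =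
      K * (t * (θ x * ‖ξ x‖ ^ 2 + (1 + θ x) * u x ^ 2) +
        1 / t * (θ x * ‖η x‖ ^ 2 + (1 + θ x) * v x ^ 2)) * w x := by
      unfold energyDensity; ring
    rw [e]
    refine mul_le_mul_of_nonneg_right ?_ pw.le
    rw [abs_le]
    constructor <;> linarith

lemma aesm_apply {g : Eu d → Eu d} {μ : Measure (Eu d)} (hg : AEStronglyMeasurable g μ)
    (i : Fin d) : AEStronglyMeasurable (fun x => g x i) μ :=
  (EuclideanSpace.proj (𝕜 := ℝ) i).continuous.comp_aestronglyMeasurable hg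

lemma aesm_sum {f : Fin d → Eu d → ℝ} {μ : Measure (Eu d)}
    (hf : ∀ i, AEStronglyMeasurable (f i) μ) : AEStronglyMeasurable (fun x => ∑ i, f i x) μ := by
  have := Finset.aestronglyMeasurable_sum Finset.univ fun i _ => hf i
  convert this using 1
  ext x
  simp

lemma Coefficients.Bounds.integrableOn_densities (hO : IsOpen O) (hw : IsWeight O w)
    (hθ : IsDegeneracyCoefficient O θ) (hK : 0 < K) (hA : A.Bounds O θ K)
    {u v : Eu d → ℝ} {ξ η : Eu d → Eu d} (hu : FiniteEnergy O θ w u ξ)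
    (hv : FiniteEnergy O θ w v η) :
    IntegrableOn (formDensity A w u ξ v η) O ∧ IntegrableOn (lowerDensity A w u ξ v η) O := by
  have ma := fun i j => (hA.a_meas i j).aestronglyMeasurable
  have me := fun i => aesm_apply hA.e_meas.aestronglyMeasurable i
  have mb := fun i => aesm_apply hA.b_meas.aestronglyMeasurable i
  have mc := hA.c_meas.aestronglyMeasurable
  have mξ := fun i => aesm_apply hu.meas_grad i
  have mη := fun i => aesm_apply hv.meas_grad i
  have mw := hw.aesm hO
  have hb := hA.abs_formDensity_le hO hw hθ hK
  have hi := ((hu.integrable.const_mul 1).add (hv.integrable.const_mul (1 / 1))).const_mul K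
  constructor
  · refine Integrable.mono' hi ?_ (hb.mono fun x hx => (hx u ξ v η 1 one_pos).1)
    exact ((((aesm_sum fun i => aesm_sum fun j => ((ma i j).mul (mξ i)).mul (mη j)).add
      (aesm_sum fun j => ((me j).mul hu.meas).mul (mη j))).sub
      (aesm_sum fun i => ((mb i).mul (mξ i)).mul hv.meas)).add
      ((mc.mul hu.meas).mul hv.meas)).mul mw
  · refine Integrable.mono' hi ?_ (hb.mono fun x hx => (hx u ξ v η 1 one_pos).2)
    exact (((aesm_sum fun j => ((me j).mul hu.meas).mul (mη j)).add
      (aesm_sum fun j => ((me j).mul hv.meas).mul (mξ j))).add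
      ((mc.mul hu.meas).mul hv.meas)).mul mw

lemma Coefficients.Bounds.abs_integral_le (hO : IsOpen O) (hw : IsWeight O w)
    (hθ : IsDegeneracyCoefficient O θ) (hK : 0 < K) (hA : A.Bounds O θ K)
    {u v : Eu d → ℝ} {ξ η : Eu d → Eu d} (hu : FiniteEnergy O θ w u ξ)
    (hv : FiniteEnergy O θ w v η) {t : ℝ} (ht : 0 < t) :
    |∫ x in O, formDensity A w u ξ v η x| ≤ K * (t * (∫ x in O, energyDensity θ w u ξ x) +
      1 / t * ∫ x in O, energyDensity θ w v η x) ∧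
    |∫ x in O, lowerDensity A w u ξ v η x| ≤ K * (t * (∫ x in O, energyDensity θ w u ξ x) +
      1 / t * ∫ x in O, energyDensity θ w v η x) := by
  have hb := hA.abs_formDensity_le hO hw hθ hK
  have hi : IntegrableOn (fun x => K * (t * energyDensity θ w u ξ x +
      1 / t * energyDensity θ w v η x)) O :=
    ((hu.integrable.const_mul t).add (hv.integrable.const_mul (1 / t))).const_mul K
  have e : K * (t * (∫ x in O, energyDensity θ w u ξ x) +
      1 / t * ∫ x in O, energyDensity θ w v η x) =
      ∫ x in O, K * (t * energyDensity θ w u ξ x + 1 / t * energyDensity θ w v η x) := by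
    rw [integral_const_mul, integral_add (hu.integrable.const_mul t)
      (hv.integrable.const_mul (1 / t)), integral_const_mul, integral_const_mul]
  rw [e]
  constructor <;> rw [← Real.norm_eq_abs]
  · exact norm_integral_le_of_norm_le hi (hb.mono fun x hx => (hx u ξ v η t ht).1)
  · exact norm_integral_le_of_norm_le hi (hb.mono fun x hx => (hx u ξ v η t ht).2)

lemma formDensity_add_right (u v v' : Eu d → ℝ) (ξ η η' : Eu d → Eu d) (x : Eu d) :
    formDensity A w u ξ (v + v') (η + η') x =
      formDensity A w u ξ v η x + formDensity A w u ξ v' η' x := by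
  simp only [formDensity, Pi.add_apply, PiLp.add_apply, mul_add, Finset.sum_add_distrib]
  ring

/-- Polarization, `Q(u) = Q(v) + 2 B(u, u - v) - Q(u - v)`: for an approximant `v`, both correction
terms contain the small difference `u - v`. -/
lemma lowerDensity_add_self (u v : Eu d → ℝ) (ξ η : Eu d → Eu d) (x : Eu d) :
    lowerDensity A w u ξ u ξ x = lowerDensity A w v η v η x +
      (2 * lowerDensity A w u ξ (u - v) (ξ - η) x -
        lowerDensity A w (u - v) (ξ - η) (u - v) (ξ - η) x) := by
  simp only [lowerDensity, sum_mul_mul_eq, Pi.sub_apply, inner_sub_right]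
  ring

/-- The coefficient bounds hold everywhere on `O`, by continuity. -/
lemma Coefficients.Bounds.abs_le_of_regular (hO : IsOpen O) (hθ : IsDegeneracyCoefficient O θ)
    (hA : A.Bounds O θ K) (hreg : A.Regular O S θ w) {x : Eu d} (hx : x ∈ O) :
    (∀ i j, |A.a x i j| ≤ K * θ x) ∧ ∀ j, |A.e x j| ≤ K * θ x := by
  have cθ : ContinuousOn (fun x => K * θ x) O :=
    continuousOn_const.mul (hθ.continuousOn.mono subset_closure)
  have ext : ∀ f : Eu d → ℝ, ContinuousOn f O → (∀ᵐ x ∂volume.restrict O, |f x| ≤ K * θ x) →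
      |f x| ≤ K * θ x := by
    intro f hf h
    -- The inequality is recast as an equality of continuous functions, and a.e. equality of these
    -- on an open set is equality everywhere.
    have h1 : (fun x => max (|f x|) (K * θ x)) =ᵐ[volume.restrict O] fun x => K * θ x :=
      h.mono fun y hy => max_eq_right hy
    have := Measure.eqOn_open_of_ae_eq h1 hO (hf.abs.sup cθ) cθ hx
    exact le_trans (le_max_left _ _) this.le
  constructor
  · intro i j
    refine ext _ ((hreg.a_cont i j).mono subset_closure) ?_
    filter_upwards [ae_restrict_mem hO.measurableSet, hA.a_lower, hA.a_upper] with y hy h1 h2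
    have pθ := hθ.pos y hy
    have a0 : ∀ η : Eu d, 0 ≤ ∑ i, ∑ j, A.a y i j * η i * η j := fun η =>
      le_trans (by positivity) (h1 η)
    -- On basis vectors with `t = 1` this reads `|a^{ij}| ≤ (a^{ii} + a^{jj}) / 2`.
    have ba := abs_sum_mul_mul_le (hA.a_symm hy) a0 (EuclideanSpace.single i 1)
      (EuclideanSpace.single j 1) one_pos
    have e : ∑ i', ∑ j', A.a y i' j' * (EuclideanSpace.single i (1 : ℝ) : Eu d) i' *
        (EuclideanSpace.single j (1 : ℝ) : Eu d) j' = A.a y i j := by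
      simp
    rw [e] at ba
    have b1 := h2 (EuclideanSpace.single i 1)
    have b2 := h2 (EuclideanSpace.single j 1)
    simp only [PiLp.norm_single, norm_one, one_pow, mul_one] at b1 b2
    linarith
  · intro j
    refine ext _ ((hreg.e_cont j).mono subset_closure) ?_
    filter_upwards [hA.e_bound] with y hy
    have := hy (EuclideanSpace.single j 1)
    simpa [EuclideanSpace.inner_single_right] using this

end FormBounds

/-! ### Calculus of locally Lipschitz functions and Rademacher's theorem. -/

section LocallyLipschitz

variable {d : ℕ} {O S : Set (Eu d)} {θ w : Eu d → ℝ}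

lemma locallyLipschitzOn_comp {E F G : Type*} [PseudoEMetricSpace E] [PseudoEMetricSpace F]
    [PseudoEMetricSpace G] {s : Set E} {f : E → F} {Φ : F → G} (hΦ : LocallyLipschitz Φ)
    (hf : LocallyLipschitzOn s f) : LocallyLipschitzOn s fun x => Φ (f x) := by
  rw [locallyLipschitzOn_iff_restrict] at hf ⊢
  exact hΦ.comp hf

lemma locallyLipschitzOn_real_mul {E : Type*} [PseudoEMetricSpace E] {s : Set E} {f g : E → ℝ}
    (hf : LocallyLipschitzOn s f) (hg : LocallyLipschitzOn s g) :
    LocallyLipschitzOn s fun x => f x * g x := by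
  have h : LocallyLipschitz fun p : ℝ × ℝ => p.1 * p.2 :=
    ContDiff.locallyLipschitz (𝕂 := ℝ) (contDiff_fst.mul contDiff_snd)
  rw [locallyLipschitzOn_iff_restrict] at hf hg ⊢
  exact h.comp (hf.prodMk hg)

lemma locallyLipschitzOn_sum {E F ι : Type*} [PseudoEMetricSpace E] [NormedAddCommGroup F]
    {s : Set E} (t : Finset ι) {f : ι → E → F} (hf : ∀ i, LocallyLipschitzOn s (f i)) :
    LocallyLipschitzOn s fun x => ∑ i ∈ t, f i x := by
  classical
  induction t using Finset.induction_on with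
  | empty => simpa using (LocallyLipschitz.const (0 : F)).locallyLipschitzOn
  | insert a t ha ih =>
    simp only [Finset.sum_insert ha]
    exact (hf a).add ih

/-- Rademacher's theorem for locally Lipschitz functions on open sets. -/
lemma LocallyLipschitzOn.ae_differentiableAt (hO : IsOpen O) {f : Eu d → ℝ}
    (hf : LocallyLipschitzOn O f) : ∀ᵐ x ∂volume.restrict O, DifferentiableAt ℝ f x := by
  rw [ae_restrict_iff' hO.measurableSet]
  have h : volume {x ∈ O | ¬DifferentiableAt ℝ f x} = 0 := by
    refine measure_null_of_locally_null _ fun x hx => ?_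
    obtain ⟨C, t, ht, hC⟩ := hf hx.1
    rw [hO.nhdsWithin_eq hx.1] at ht
    obtain ⟨U, hUt, hU, hxU⟩ := mem_nhds_iff.1 ht
    refine ⟨{x ∈ O | ¬DifferentiableAt ℝ f x} ∩ U,
      inter_mem self_mem_nhdsWithin (mem_nhdsWithin_of_mem_nhds (hU.mem_nhds hxU)), ?_⟩
    have h1 := (hC.mono hUt).ae_differentiableWithinAt_of_mem (μ := volume)
    refine measure_mono_null ?_ h1
    intro y hy hy'
    exact hy.1.2 ((hy' hy.2).differentiableAt (hU.mem_nhds hy.2))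
  refine measure_mono_null ?_ h
  intro x hx
  simpa using hx

lemma pderiv_mul {f g : Eu d → ℝ} {x : Eu d} (hf : DifferentiableAt ℝ f x)
    (hg : DifferentiableAt ℝ g x) (i : Fin d) :
    pderiv i (fun y => f y * g y) x = pderiv i f x * g x + f x * pderiv i g x := by
  simp only [pderiv, fderiv_fun_mul hf hg]
  simp only [add_apply, smul_apply, smul_eq_mul]
  ring

lemma pderiv_add {f g : Eu d → ℝ} {x : Eu d} (hf : DifferentiableAt ℝ f x)
    (hg : DifferentiableAt ℝ g x) (i : Fin d) :
    pderiv i (fun y => f y + g y) x = pderiv i f x + pderiv i g x := by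
  simp only [pderiv, fderiv_fun_add hf hg, add_apply]

lemma pderiv_sum {ι : Type*} (t : Finset ι) {f : ι → Eu d → ℝ} {x : Eu d}
    (hf : ∀ k, DifferentiableAt ℝ (f k) x) (i : Fin d) :
    pderiv i (fun y => ∑ k ∈ t, f k y) x = ∑ k ∈ t, pderiv i (f k) x := by
  simp only [pderiv]
  rw [fderiv_fun_sum fun k _ => hf k, sum_apply]

lemma pderiv_congr {f g : Eu d → ℝ} {x : Eu d} (h : f =ᶠ[𝓝 x] g) (i : Fin d) :
    pderiv i f x = pderiv i g x := by
  simp only [pderiv, h.fderiv_eq]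

lemma pderiv_exp {f : Eu d → ℝ} {x : Eu d} (hf : DifferentiableAt ℝ f x) (i : Fin d) :
    pderiv i (fun y => Real.exp (f y)) x = Real.exp (f x) * pderiv i f x := by
  simp only [pderiv, fderiv_exp hf]
  simp

lemma contDiff_pderiv {f : Eu d → ℝ} (hf : ContDiff ℝ ∞ f) (i : Fin d) :
    ContDiff ℝ ∞ (pderiv i f) :=
  (hf.fderiv_right (m := ∞) (by simp)).clm_apply contDiff_const

end LocallyLipschitz

/-! ### The flux field and integration by parts against test functions. -/

section IntegrationByParts

variable {d : ℕ} {O S : Set (Eu d)} {θ w : Eu d → ℝ} {A : Coefficients d} {K : ℝ}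

/-- The nondivergence-form operator `-a^{ij} g_{x_i x_j} - b̃^i g_{x_i} + c̃ g`. -/
noncomputable def nonDivOp {d : ℕ} (A : Coefficients d) (w g : Eu d → ℝ) (x : Eu d) : ℝ :=
  A.cTilde w x * g x - (∑ i, A.bTilde w x i * pderiv i g x)
    - ∑ i, ∑ j, A.a x i j * pderiv j (pderiv i g) x

open Classical in
/-- The vector field `(a^{ij} g_{x_i} + d^j g) v w` on `O`, extended by zero. -/
noncomputable def fluxField {d : ℕ} (A : Coefficients d) (O : Set (Eu d)) (w g v : Eu d → ℝ)
    (x : Eu d) : Eu d :=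
  if x ∈ O then
    WithLp.toLp 2 fun j => ((∑ i, A.a x i j * pderiv i g x) + A.e x j * g x) * v x * w x
  else 0

lemma fluxField_apply {g v : Eu d → ℝ} {x : Eu d} (hx : x ∈ O) (j : Fin d) :
    fluxField A O w g v x j =
      ((∑ i, A.a x i j * pderiv i g x) + A.e x j * g x) * v x * w x := by
  simp [fluxField, hx]

lemma fluxField_of_notMem {g v : Eu d → ℝ} {x : Eu d} (hx : x ∉ O) :
    fluxField A O w g v x = 0 := by simp [fluxField, hx]

lemma fluxField_of_eq_zero {g v : Eu d → ℝ} {x : Eu d} (hx : v x = 0) :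
    fluxField A O w g v x = 0 := by
  unfold fluxField
  split_ifs
  · ext j; simp [hx]
  · rfl

/-- The expanded product rule, with `a'`, `e'`, `l`, `h`, `g1`, `v1` standing for the derivatives of
`a`, `d`, `log w`, for the Hessian of `g` and for the gradients of `g` and `v`. The terms in `b` and
`c` do not occur in the divergence: they cancel between the form and the operator. -/
lemma divergence_algebra (a : Matrix (Fin d) (Fin d) ℝ) (a' h : Fin d → Fin d → ℝ)
    (g1 e e' b l v1 : Fin d → ℝ) (c g v w : ℝ) :
    ∑ j, ((((∑ i, (a' i j * g1 i + a i j * h i j)) + (e' j * g + e j * g1 j)) * v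
        + ((∑ i, a i j * g1 i) + e j * g) * v1 j) * w
        + ((∑ i, a i j * g1 i) + e j * g) * v * (w * l j)) =
    ((∑ i, ∑ j, a i j * g1 i * v1 j) + (∑ j, e j * g * v1 j) - (∑ i, b i * g1 i * v)
      + c * g * v) * w -
    ((c - (∑ j, e' j) - ∑ j, l j * e j) * g
      - (∑ i, (b i + (∑ j, a' i j) + e i + ∑ j, l j * a i j) * g1 i)
      - ∑ i, ∑ j, a i j * h i j) * v * w := by
  have s1 : ∑ j, ∑ i, a' i j * g1 i = ∑ i, (∑ j, a' i j) * g1 i := by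
    rw [Finset.sum_comm]; simp only [Finset.sum_mul]
  have s2 : ∑ j, ∑ i, a i j * h i j = ∑ i, ∑ j, a i j * h i j := Finset.sum_comm
  have s3 : ∑ j, (∑ i, a i j * g1 i) * v1 j = ∑ i, ∑ j, a i j * g1 i * v1 j := by
    simp only [Finset.sum_mul]; exact Finset.sum_comm
  have s4 : ∑ j, (∑ i, a i j * g1 i) * l j = ∑ i, (∑ j, l j * a i j) * g1 i := by
    simp only [Finset.sum_mul]; rw [Finset.sum_comm]
    exact Finset.sum_congr rfl fun i _ => Finset.sum_congr rfl fun j _ => by ring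
  have t1 : ∑ j, e' j * g = (∑ j, e' j) * g := by rw [Finset.sum_mul]
  have t2 : ∑ j, l j * e j * g = (∑ j, l j * e j) * g := by rw [Finset.sum_mul]
  have t3 : ∑ i, b i * g1 i * v = (∑ i, b i * g1 i) * v := by rw [Finset.sum_mul]
  have lhs : ∑ j, ((((∑ i, (a' i j * g1 i + a i j * h i j)) + (e' j * g + e j * g1 j)) * v
        + ((∑ i, a i j * g1 i) + e j * g) * v1 j) * w
        + ((∑ i, a i j * g1 i) + e j * g) * v * (w * l j)) =
      (∑ j, ∑ i, a' i j * g1 i) * (v * w) + (∑ j, ∑ i, a i j * h i j) * (v * w)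
        + (∑ j, e' j * g) * (v * w) + (∑ j, e j * g1 j) * (v * w)
        + (∑ j, (∑ i, a i j * g1 i) * v1 j) * w + (∑ j, e j * g * v1 j) * w
        + (∑ j, (∑ i, a i j * g1 i) * l j) * (v * w) + (∑ j, l j * e j * g) * (v * w) := by
    rw [Finset.sum_mul, Finset.sum_mul, Finset.sum_mul, Finset.sum_mul, Finset.sum_mul,
      Finset.sum_mul, Finset.sum_mul, Finset.sum_mul]
    simp only [← Finset.sum_add_distrib]
    refine Finset.sum_congr rfl fun j _ => ?_
    rw [Finset.sum_add_distrib]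
    ring
  rw [lhs, s1, s2, s3, s4, t1, t2, t3]
  simp only [add_mul, Finset.sum_add_distrib]
  ring

/-- The divergence of the flux field. -/
lemma ae_divergence_fluxField (hO : IsOpen O) (hw : IsWeight O w) (hreg : A.Regular O S θ w)
    {g v : Eu d → ℝ} (hg : ContDiff ℝ ∞ g) (hv : ContDiff ℝ ∞ v) :
    ∀ᵐ x ∂volume.restrict O, divergence (fluxField A O w g v) x =
      formDensity A w g (gradVec g) v (gradVec v) x - nonDivOp A w g x * v x * w x := by
  have ha := ae_all_iff.2 fun i => ae_all_iff.2 fun j => (hreg.a_lip i j).ae_differentiableAt hO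
  have he := ae_all_iff.2 fun j => (hreg.e_lip j).ae_differentiableAt hO
  filter_upwards [ae_restrict_mem hO.measurableSet, ha, he, hreg.log_lip.ae_differentiableAt hO]
    with x hx ha he hl
  have dg : DifferentiableAt ℝ g x := hg.differentiable (by simp) x
  have dv : DifferentiableAt ℝ v x := hv.differentiable (by simp) x
  have dg1 : ∀ i, DifferentiableAt ℝ (pderiv i g) x := fun i =>
    (contDiff_pderiv hg i).differentiable (by simp) x
  have hexp : Real.exp (Real.log (w x)) = w x := Real.exp_log (hw.pos x hx)
  have key : ∀ j, pderiv j (fun y => fluxField A O w g v y j) x =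
      (((∑ i, (pderiv j (fun y => A.a y i j) x * pderiv i g x +
        A.a x i j * pderiv j (pderiv i g) x)) +
        (pderiv j (fun y => A.e y j) x * g x + A.e x j * pderiv j g x)) * v x
        + ((∑ i, A.a x i j * pderiv i g x) + A.e x j * g x) * pderiv j v x) * w x
        + ((∑ i, A.a x i j * pderiv i g x) + A.e x j * g x) * v x *
          (w x * pderiv j (fun y => Real.log (w y)) x) := by
    intro j
    -- Regularity is assumed for `log w` only, so `w` is differentiated as `exp (log w)`.
    have e1 : (fun y => fluxField A O w g v y j) =ᶠ[𝓝 x] fun y =>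
        ((∑ i, A.a y i j * pderiv i g y) + A.e y j * g y) * v y * Real.exp (Real.log (w y)) := by
      filter_upwards [hO.mem_nhds hx] with y hy
      rw [fluxField_apply hy, Real.exp_log (hw.pos y hy)]
    have d1 : ∀ i, DifferentiableAt ℝ (fun y => A.a y i j * pderiv i g y) x := fun i =>
      (ha i j).mul (dg1 i)
    have d2 : DifferentiableAt ℝ (fun y => ∑ i, A.a y i j * pderiv i g y) x :=
      DifferentiableAt.fun_sum fun i _ => d1 i
    have d3 : DifferentiableAt ℝ (fun y => A.e y j * g y) x := (he j).mul dg
    have d4 : DifferentiableAt ℝ (fun y => (∑ i, A.a y i j * pderiv i g y) + A.e y j * g y) x :=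
      d2.add d3
    have d5 : DifferentiableAt ℝ
        (fun y => ((∑ i, A.a y i j * pderiv i g y) + A.e y j * g y) * v y) x := d4.mul dv
    rw [pderiv_congr e1, pderiv_mul d5 hl.exp, pderiv_mul d4 dv, pderiv_add d2 d3,
      pderiv_sum _ d1, pderiv_mul (he j) dg, pderiv_exp hl, hexp]
    simp only [pderiv_mul (ha _ j) (dg1 _)]
  unfold divergence
  simp only [key]
  exact divergence_algebra (A.a x) (fun i j => pderiv j (fun y => A.a y i j) x)
    (fun i j => pderiv j (pderiv i g) x) (fun i => pderiv i g x) (A.e x)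
    (fun j => pderiv j (fun y => A.e y j) x) (A.b x)
    (fun j => pderiv j (fun y => Real.log (w y)) x) (fun j => pderiv j v x) (A.c x) (g x) (v x)
    (w x)

lemma locallyLipschitzOn_fluxField (hw : IsWeight O w) (hreg : A.Regular O S θ w)
    {g v : Eu d → ℝ} (hg : ContDiff ℝ ∞ g) (hv : ContDiff ℝ ∞ v) :
    LocallyLipschitzOn O (fluxField A O w g v) := by
  have lip : ∀ {f : Eu d → ℝ}, ContDiff ℝ ∞ f → LocallyLipschitzOn O f := fun hf =>
    (hf.of_le (by simp)).locallyLipschitz.locallyLipschitzOn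
  have hl := locallyLipschitzOn_comp (Real.contDiff_exp.of_le le_top).locallyLipschitz hreg.log_lip
  have hj : ∀ j, LocallyLipschitzOn O fun x =>
      (((∑ i, A.a x i j * pderiv i g x) + A.e x j * g x) * v x * Real.exp (Real.log (w x))) •
        (EuclideanSpace.single j (1 : ℝ) : Eu d) := by
    intro j
    have h1 : LocallyLipschitzOn O fun x => ∑ i, A.a x i j * pderiv i g x :=
      locallyLipschitzOn_sum _ fun i =>
        locallyLipschitzOn_real_mul (hreg.a_lip i j) (lip (contDiff_pderiv hg i))
    have h2 := locallyLipschitzOn_real_mul (hreg.e_lip j) (lip hg)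
    have h3 := locallyLipschitzOn_real_mul (locallyLipschitzOn_real_mul (h1.add h2) (lip hv)) hl
    exact locallyLipschitzOn_comp (Φ := fun r : ℝ => r • (EuclideanSpace.single j (1 : ℝ) : Eu d))
      (ContDiff.locallyLipschitz (𝕂 := ℝ) (contDiff_id.smul contDiff_const)) h3
  have hsum := locallyLipschitzOn_sum Finset.univ hj
  have e : ∀ x ∈ O, fluxField A O w g v x = ∑ j,
      (((∑ i, A.a x i j * pderiv i g x) + A.e x j * g x) * v x * Real.exp (Real.log (w x))) •
        (EuclideanSpace.single j (1 : ℝ) : Eu d) := by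
    intro x hx
    ext k
    rw [fluxField_apply hx, Real.exp_log (hw.pos x hx)]
    simp [Finset.sum_apply, Pi.single_apply]
  have e' : O.domRestrict (fluxField A O w g v) = O.domRestrict fun x => ∑ j,
      (((∑ i, A.a x i j * pderiv i g x) + A.e x j * g x) * v x * Real.exp (Real.log (w x))) •
        (EuclideanSpace.single j (1 : ℝ) : Eu d) := by
    ext1 x
    exact e x x.2
  rw [locallyLipschitzOn_iff_restrict] at hsum ⊢
  rw [e']
  exact hsum

/-- The flux field is continuous up to the boundary, where it vanishes. -/
lemma continuousOn_fluxField (hO : IsOpen O)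
    (hw : IsWeight O w) (hθ : IsDegeneracyCoefficient O θ) (hA : A.Bounds O θ K)
    (hreg : A.Regular O S θ w) {g v : Eu d → ℝ} (hg : ContDiff ℝ ∞ g)
    (hv : IsTestFunction O S v) : ContinuousOn (fluxField A O w g v) (closure O) := by
  intro x hx
  by_cases hxO : x ∈ O
  · have := (locallyLipschitzOn_fluxField hw hreg hg hv.1).continuousOn.continuousAt
      (hO.mem_nhds hxO)
    exact this.continuousWithinAt
  rw [ContinuousWithinAt, fluxField_of_notMem hxO]
  obtain ⟨C, hC, hCO, h0⟩ := hv.2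
  by_cases hxC : x ∈ C
  · have hxS : x ∈ S := (hCO hxC).resolve_left hxO
    obtain ⟨ρ, ρc, ρe, ρ0⟩ := hreg.weight_cont
    have hcomp : ∀ j, Tendsto (fun y => fluxField A O w g v y j) (𝓝[closure O] x) (𝓝 0) := by
      intro j
      set M : Eu d → ℝ := fun y => K * ((∑ i, |pderiv i g y|) + |g y|) * |v y| with hM
      have cM : Continuous M :=
        (continuous_const.mul ((continuous_finsetSum _ fun i _ =>
          (continuous_pderiv hg i).abs).add hg.continuous.abs)).mul hv.1.continuous.abs
      have lim : Tendsto (fun y => |M y| * |ρ y|) (𝓝[closure O] x) (𝓝 0) := by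
        have h1 : Tendsto (fun y => |M y|) (𝓝[closure O] x) (𝓝 |M x|) :=
          (cM.abs.tendsto x).mono_left nhdsWithin_le_nhds
        have h2 : Tendsto (fun y => |ρ y|) (𝓝[closure O] x) (𝓝 |ρ x|) := (ρc x hx).abs
        simpa [ρ0 x hxS] using h1.mul h2
      refine squeeze_zero_norm (fun y => ?_) lim
      by_cases hy : y ∈ O
      · obtain ⟨ba, be⟩ := hA.abs_le_of_regular hO hθ hreg hy
        have pw := hw.pos y hy
        have pθ := hθ.pos y hy
        rw [fluxField_apply hy, Real.norm_eq_abs, ← abs_mul]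
        refine le_trans ?_ (le_abs_self _)
        rw [ρe y hy, abs_mul, abs_mul, abs_of_pos pw]
        have b1 : |(∑ i, A.a y i j * pderiv i g y) + A.e y j * g y| ≤
            K * θ y * ((∑ i, |pderiv i g y|) + |g y|) := by
          refine (abs_add_le _ _).trans ?_
          rw [mul_add, Finset.mul_sum]
          refine add_le_add ((Finset.abs_sum_le_sum_abs _ _).trans
            (Finset.sum_le_sum fun i _ => ?_)) ?_
          · rw [abs_mul]; gcongr; exact ba i j
          · rw [abs_mul]; gcongr; exact be j
        calc _ ≤ K * θ y * ((∑ i, |pderiv i g y|) + |g y|) * |v y| * w y := by gcongr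
          _ = M y * (θ y * w y) := by simp only [hM]; ring
      · rw [fluxField_of_notMem hy]
        simp only [PiLp.zero_apply, norm_zero]
        positivity
    have := tendsto_pi_nhds.2 hcomp
    exact ((PiLp.continuous_toLp 2 _).tendsto _).comp this
  · have : ∀ᶠ y in 𝓝[closure O] x, fluxField A O w g v y = 0 := by
      filter_upwards [mem_nhdsWithin_of_mem_nhds (hC.isClosed.isOpen_compl.mem_nhds hxC)] with y hy
      by_cases hyO : y ∈ O
      · exact fluxField_of_eq_zero (h0 y hyO hy)
      · exact fluxField_of_notMem hyO
    exact tendsto_const_nhds.congr' (this.mono fun y hy => hy.symm)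

/-- On the compact set `C` the function and its gradient are bounded, while `w` and `θ w` are
integrable. -/
lemma IsTestFunction.finiteEnergy (hO : IsOpen O) (hw : IsWeight O w)
    (hθ : IsDegeneracyCoefficient O θ) (hθw : IntegrableOn (fun x => θ x * w x) O)
    {v : Eu d → ℝ} (hv : IsTestFunction O S v) : FiniteEnergy O θ w v (gradVec v) := by
  obtain ⟨C, hC, -, h0⟩ := hv.2
  obtain ⟨B, hB⟩ := hC.exists_bound_of_continuousOn
    (hv.1.continuous.norm.add (continuous_gradVec hv.1).norm).continuousOn
  have hD : IntegrableOn (fun x => B ^ 2 * (w x + 2 * (θ x * w x))) O :=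
    (hw.integrableOn.add (hθw.const_mul 2)).const_mul _
  refine .of_le hO hw hθ hv.1.continuous.aestronglyMeasurable
    (continuous_gradVec hv.1).aestronglyMeasurable hD fun x hx => ?_
  have pw := hw.pos x hx
  have pθ := hθ.pos x hx
  by_cases hxC : x ∈ C
  · have hb : ‖v x‖ + ‖gradVec v x‖ ≤ B := (le_abs_self _).trans (hB x hxC)
    have n1 := norm_nonneg (v x)
    have n2 := norm_nonneg (gradVec v x)
    have b1 : v x ^ 2 ≤ B ^ 2 := by
      rw [← sq_abs]; exact pow_le_pow_left₀ (abs_nonneg _) (by rw [← Real.norm_eq_abs]; linarith) 2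
    have b2 : ‖gradVec v x‖ ^ 2 ≤ B ^ 2 := pow_le_pow_left₀ n2 (by linarith) 2
    calc energyDensity θ w v (gradVec v) x
        ≤ (θ x * B ^ 2 + (1 + θ x) * B ^ 2) * w x := by unfold energyDensity; gcongr
      _ = _ := by ring
  · have hev : v =ᶠ[𝓝 x] fun _ => 0 := by
      filter_upwards [hO.mem_nhds hx, hC.isClosed.isOpen_compl.mem_nhds hxC] with y h1 h2
      exact h0 y h1 h2
    have hg : gradVec v x = 0 := by
      ext i
      rw [gradVec_apply, pderiv_congr hev]
      simp [pderiv]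
    simp only [energyDensity, hg, h0 x hx hxC]
    simp
    positivity

lemma FiniteEnergy.integrableOn_mul (hO : IsOpen O) (hw : IsWeight O w)
    (hθ : IsDegeneracyCoefficient O θ) {u : Eu d → ℝ} {g : Eu d → Eu d}
    (h : FiniteEnergy O θ w u g) : IntegrableOn (fun x => u x * w x) O := by
  refine Integrable.mono' (hw.integrableOn.add h.integrable) (h.meas.mul (hw.aesm hO)) ?_
  filter_upwards [ae_restrict_mem hO.measurableSet] with x hx
  have pw := hw.pos x hx
  have pθ := hθ.pos x hx
  rw [Real.norm_eq_abs, abs_mul, abs_of_pos pw]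
  have h1 : |u x| ≤ 1 + u x ^ 2 := by nlinarith [sq_nonneg (|u x| - 1), sq_abs (u x)]
  have h2 : 0 ≤ θ x * ‖g x‖ ^ 2 := by positivity
  have h3 : 0 ≤ θ x * u x ^ 2 := by positivity
  calc |u x| * w x ≤ (1 + (θ x * ‖g x‖ ^ 2 + (1 + θ x) * u x ^ 2)) * w x := by
        gcongr; linarith
    _ = _ := by simp only [Pi.add_apply, energyDensity]; ring

/-- Integration by parts against nonnegative test functions. -/
lemma integral_le_of_nonDivOp_ge (hO : IsOpen O) (hdiv : DivergenceTheoremHolds O)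
    (hw : IsWeight O w) (hθ : IsDegeneracyCoefficient O θ)
    (hθw : IntegrableOn (fun x => θ x * w x) O) (hK : 0 < K) (hA : A.Bounds O θ K)
    (hreg : A.Regular O S θ w) {g v : Eu d → ℝ} (hg : ContDiff ℝ ∞ g)
    (hgfe : FiniteEnergy O θ w g (gradVec g)) {κ : ℝ}
    (hκ : ∀ᵐ x ∂volume.restrict O, κ ≤ nonDivOp A w g x) (hv : v ∈ nonnegTest O S) :
    κ * (∫ x in O, v x * w x) ≤ ∫ x in O, formDensity A w g (gradVec g) v (gradVec v) x := by
  obtain ⟨σ, n, -, hσ, -, -, H⟩ := hdiv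
  set F := fluxField A O w g v with hF
  have hvfe := hv.1.finiteEnergy hO hw hθ hθw
  have hform := (hA.integrableOn_densities hO hw hθ hK hgfe hvfe).1
  have hvw := hvfe.integrableOn_mul hO hw hθ
  -- Only a lower bound on `nonDivOp` is available, so the divergence has an integrable majorant but
  -- no a priori integrable minorant; hence the one-sided hypothesis in the divergence theorem.
  have hle : ∀ᵐ x ∂volume.restrict O, divergence F x ≤
      formDensity A w g (gradVec g) v (gradVec v) x - κ * (v x * w x) := by
    filter_upwards [ae_restrict_mem hO.measurableSet, hκ,
      ae_divergence_fluxField hO hw hreg hg hv.1.1] with x hx h1 h2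
    rw [h2]
    have : κ * (v x * w x) ≤ nonDivOp A w g x * (v x * w x) :=
      mul_le_mul_of_nonneg_right h1 (mul_nonneg (hv.2 x) (hw.pos x hx).le)
    linarith
  have hdom := hform.sub (hvw.const_mul κ)
  have hmeas : Measurable (divergence F) := by
    unfold divergence pderiv
    exact Finset.measurable_fun_sum _ fun i _ => measurable_fderiv_apply_const ℝ _ _
  obtain ⟨C, hC, -, h0⟩ := hv.1.2
  obtain ⟨i1, i2⟩ := H F (continuousOn_fluxField hO hw hθ hA hreg hg hv.1)
    ⟨C, hC, fun x _ hxC => by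
      by_cases hx : x ∈ O
      · exact fluxField_of_eq_zero (h0 x hx hxC)
      · exact fluxField_of_notMem hx⟩
    (locallyLipschitzOn_fluxField hw hreg hg hv.1.1) (by
      refine Integrable.mono' hdom.norm (hmeas.max measurable_const).aestronglyMeasurable ?_
      filter_upwards [hle] with x hx
      rw [Real.norm_of_nonneg (le_max_right _ _)]
      refine max_le (hx.trans ?_) (norm_nonneg _)
      exact le_abs_self _)
  -- The measure `σ` lives on the boundary, which is disjoint from the open set `O`, and the flux is
  -- zero off `O`.
  have hz : ∫ x, inner ℝ (F x) (n x) ∂σ = 0 := by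
    refine integral_eq_zero_of_ae ?_
    have : ∀ᵐ x ∂σ, x ∈ frontier O := hσ
    filter_upwards [this] with x hx
    rw [hO.frontier_eq] at hx
    rw [hF, fluxField_of_notMem hx.2]
    simp
  rw [hz, neg_zero] at i2
  have := integral_mono_ae i1 hdom hle
  rw [i2] at this
  have e := integral_sub hform (hvw.const_mul κ)
  rw [integral_const_mul] at e
  change 0 ≤ ∫ x in O, (formDensity A w g (gradVec g) v (gradVec v) x - κ * (v x * w x)) at this
  rw [e] at this
  linarith

end IntegrationByParts

/-! ### The logarithmic barrier as a supersolution of finite energy. -/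

section Barrier

variable {d : ℕ} {O S : Set (Eu d)} {θ w : Eu d → ℝ} {A : Coefficients d} {K : ℝ}

/-- The logarithmic barrier `κ + δ (log (1 + |x|²) + C)`. -/
noncomputable def barrier {d : ℕ} (κ δ C : ℝ) (x : Eu d) : ℝ :=
  κ + δ * (Real.log (1 + ‖x‖ ^ 2) + C)

lemma contDiff_one_add_norm_sq : ContDiff ℝ ∞ fun x : Eu d => 1 + ‖x‖ ^ 2 :=
  contDiff_const.add (contDiff_norm_sq ℝ)

lemma one_le_one_add_norm_sq (x : Eu d) : 1 ≤ 1 + ‖x‖ ^ 2 := by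
  have := sq_nonneg ‖x‖
  linarith

lemma one_add_norm_sq_pos (x : Eu d) : 0 < 1 + ‖x‖ ^ 2 :=
  one_pos.trans_le (one_le_one_add_norm_sq x)

lemma contDiff_barrier (κ δ C : ℝ) : ContDiff ℝ ∞ (barrier (d := d) κ δ C) :=
  contDiff_const.add (contDiff_const.mul
    ((contDiff_one_add_norm_sq.log fun x => (one_add_norm_sq_pos x).ne').add contDiff_const))

lemma barrier_nonneg {κ δ C : ℝ} (hκ : 0 ≤ κ) (hδ : 0 ≤ δ) (hC : 0 ≤ C) (x : Eu d) :
    0 ≤ barrier κ δ C x :=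
  add_nonneg hκ (mul_nonneg hδ (add_nonneg (Real.log_nonneg (one_le_one_add_norm_sq x)) hC))

lemma hasFDerivAt_one_add_norm_sq (x : Eu d) :
    HasFDerivAt (fun x : Eu d => 1 + ‖x‖ ^ 2) (2 • innerSL ℝ x) x :=
  (hasStrictFDerivAt_norm_sq x).hasFDerivAt.const_add 1

lemma pderiv_barrier (κ δ C : ℝ) (i : Fin d) :
    pderiv i (barrier κ δ C) = fun x : Eu d => 2 * δ * (x i * (1 + ‖x‖ ^ 2)⁻¹) := by
  ext x
  have h := (((hasFDerivAt_one_add_norm_sq x).log (one_add_norm_sq_pos x).ne').add_const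
    C).const_mul δ |>.const_add κ
  have h' : fderiv ℝ (barrier κ δ C) x = _ := h.fderiv
  rw [pderiv, h']
  simp [EuclideanSpace.inner_single_right]
  ring

lemma pderiv_pderiv_barrier (κ δ C : ℝ) (i j : Fin d) (x : Eu d) :
    pderiv j (pderiv i (barrier κ δ C)) x =
      2 * δ * ((if i = j then 1 else 0) * (1 + ‖x‖ ^ 2)⁻¹
        - x i * (2 * x j * ((1 + ‖x‖ ^ 2)⁻¹) ^ 2)) := by
  rw [pderiv_barrier]
  have h1 : HasFDerivAt (fun x : Eu d => x i) (EuclideanSpace.proj (𝕜 := ℝ) i) x :=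
    (EuclideanSpace.proj (𝕜 := ℝ) i).hasFDerivAt
  have h2 := (hasDerivAt_inv (one_add_norm_sq_pos x).ne').comp_hasFDerivAt x
    (hasFDerivAt_one_add_norm_sq x)
  have h := (h1.mul h2).const_mul (2 * δ)
  have h' : fderiv ℝ (fun x : Eu d => 2 * δ * (x i * (1 + ‖x‖ ^ 2)⁻¹)) x = _ := h.fderiv
  rw [pderiv, h']
  by_cases hij : i = j
  · subst hij
    simp [EuclideanSpace.inner_single_right]
    ring
  · simp [EuclideanSpace.inner_single_right, hij]
    ring_nf
    simp

lemma gradVec_barrier (κ δ C : ℝ) (x : Eu d) :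
    gradVec (barrier κ δ C) x = (2 * δ * (1 + ‖x‖ ^ 2)⁻¹) • x := by
  ext i
  rw [gradVec_apply, pderiv_barrier]
  simp only [PiLp.smul_apply, smul_eq_mul]
  ring

/-- With `N = 1 + |x|²`, the derivative terms are `-2δ (tr a + ⟨b̃, x⟩) / N`, at least `-2δ K₁` by
the growth condition, and `4δ ⟨a x, x⟩ / N² ≥ 0`. The constant `2 K₁ / c₀` in the barrier
contributes `c₀ δ (2 K₁ / c₀) = 2δ K₁` through the zeroth-order term and pays for the loss exactly.
-/
lemma le_nonDivOp_barrier (hO : IsOpen O) (hθ : IsDegeneracyCoefficient O θ)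
    (hA : A.Bounds O θ K) {c₀ K₁ κ δ : ℝ} (hc₀ : 0 < c₀) (hK₁ : 0 < K₁) (hκ : 0 ≤ κ)
    (hδ : 0 ≤ δ) (hc : ∀ᵐ x ∂volume.restrict O, c₀ ≤ A.cTilde w x)
    (hgrowth : ∀ᵐ x ∂volume.restrict O,
      (A.a x).trace + ∑ i, A.bTilde w x i * x i ≤ K₁ * (1 + ‖x‖ ^ 2)) :
    ∀ᵐ x ∂volume.restrict O, c₀ * κ ≤ nonDivOp A w (barrier κ δ (2 * K₁ / c₀)) x := by
  filter_upwards [ae_restrict_mem hO.measurableSet, hc, hgrowth, hA.a_lower] with x hx h1 h2 h3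
  have pθ := hθ.pos x hx
  have pN := one_add_norm_sq_pos x
  have hax : 0 ≤ ∑ i, ∑ j, A.a x i j * x i * x j := le_trans (by positivity) (h3 x)
  set N := 1 + ‖x‖ ^ 2 with hN
  have hl : 0 ≤ Real.log N := Real.log_nonneg (one_le_one_add_norm_sq x)
  have e1 : ∑ i, A.bTilde w x i * pderiv i (barrier κ δ (2 * K₁ / c₀)) x =
      2 * δ * N⁻¹ * ∑ i, A.bTilde w x i * x i := by
    rw [Finset.mul_sum]
    refine Finset.sum_congr rfl fun i _ => ?_
    rw [pderiv_barrier]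
    ring
  have e2 : ∑ i, ∑ j, A.a x i j * pderiv j (pderiv i (barrier κ δ (2 * K₁ / c₀))) x =
      2 * δ * N⁻¹ * (A.a x).trace - 4 * δ * N⁻¹ ^ 2 * ∑ i, ∑ j, A.a x i j * x i * x j := by
    rw [Matrix.trace, Finset.mul_sum, Finset.mul_sum, ← Finset.sum_sub_distrib]
    refine Finset.sum_congr rfl fun i _ => ?_
    have : 2 * δ * N⁻¹ * (A.a x).diag i =
        ∑ j, 2 * δ * N⁻¹ * (A.a x i j * if i = j then 1 else 0) := by
      simp
    rw [this, Finset.mul_sum, ← Finset.sum_sub_distrib]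
    refine Finset.sum_congr rfl fun j _ => ?_
    rw [pderiv_pderiv_barrier]
    ring
  have e3 : 2 * δ * N⁻¹ * ((A.a x).trace + ∑ i, A.bTilde w x i * x i) ≤ 2 * δ * K₁ := by
    calc _ ≤ 2 * δ * N⁻¹ * (K₁ * N) := by gcongr
      _ = _ := by field_simp
  have e4 : c₀ * barrier κ δ (2 * K₁ / c₀) x ≤ A.cTilde w x * barrier κ δ (2 * K₁ / c₀) x :=
    mul_le_mul_of_nonneg_right h1 (barrier_nonneg hκ hδ (by positivity) x)
  have e5 : c₀ * barrier κ δ (2 * K₁ / c₀) x = c₀ * κ + δ * (c₀ * Real.log N) + 2 * δ * K₁ := by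
    unfold barrier; rw [← hN]; field_simp; ring
  have e6 : 0 ≤ δ * (c₀ * Real.log N) := by positivity
  have e7 : 0 ≤ 4 * δ * N⁻¹ ^ 2 * ∑ i, ∑ j, A.a x i j * x i * x j := by positivity
  rw [nonDivOp, e1, e2]
  linarith

/-- The gradient of the barrier is bounded and its square is `O(1 + |x|²)`, since `log (s²) ≤ 2 s`
for `s = √(1 + |x|²)`. The weighted moment condition then applies through `1 + θ ≤ 2 (1 + θ²)`. -/
lemma finiteEnergy_barrier (hO : IsOpen O) (hw : IsWeight O w) (hθ : IsDegeneracyCoefficient O θ)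
    (hint : IntegrableOn (fun x => (1 + ‖x‖ ^ 2) * (1 + θ x ^ 2) * w x) O) {κ δ C : ℝ}
    (hκ : 0 ≤ κ) (hδ : 0 ≤ δ) (hC : 0 ≤ C) :
    FiniteEnergy O θ w (barrier κ δ C) (gradVec (barrier κ δ C)) := by
  have hs := contDiff_barrier (d := d) κ δ C
  refine .of_le hO hw hθ hs.continuous.aestronglyMeasurable
    (continuous_gradVec hs).aestronglyMeasurable
    (hint.const_mul (2 * ((2 * δ) ^ 2 + (κ + δ * (2 + C)) ^ 2))) fun x hx => ?_
  have pw := hw.pos x hx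
  have pθ := hθ.pos x hx
  have pN := one_add_norm_sq_pos x
  have hN1 := one_le_one_add_norm_sq x
  have g1 : ‖gradVec (barrier κ δ C) x‖ ^ 2 ≤ (2 * δ) ^ 2 := by
    rw [gradVec_barrier, norm_smul, Real.norm_of_nonneg (by positivity)]
    refine pow_le_pow_left₀ (by positivity) ?_ 2
    rw [mul_assoc]
    refine mul_le_of_le_one_right (by positivity) ?_
    rw [← div_eq_inv_mul, div_le_one pN]
    nlinarith [sq_nonneg (‖x‖ - 1), norm_nonneg x]
  set s := Real.sqrt (1 + ‖x‖ ^ 2) with hsdef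
  have hs1 : 1 ≤ s := Real.one_le_sqrt.2 hN1
  have hs2 : s ^ 2 = 1 + ‖x‖ ^ 2 := Real.sq_sqrt pN.le
  have hlog : Real.log (1 + ‖x‖ ^ 2) ≤ 2 * s := by
    rw [← hs2, Real.log_pow]
    have := Real.log_le_sub_one_of_pos (one_pos.trans_le hs1)
    push_cast
    linarith
  have g2 : barrier κ δ C x ≤ (κ + δ * (2 + C)) * s := by
    have a1 : κ ≤ κ * s := le_mul_of_one_le_right hκ hs1
    have a2 : C ≤ C * s := le_mul_of_one_le_right hC hs1
    have a3 : δ * (Real.log (1 + ‖x‖ ^ 2) + C) ≤ δ * (2 * s + C * s) := by gcongr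
    unfold barrier
    linarith
  have g3 : barrier κ δ C x ^ 2 ≤ (κ + δ * (2 + C)) ^ 2 * (1 + ‖x‖ ^ 2) := by
    rw [← hs2, ← mul_pow]
    exact pow_le_pow_left₀ (barrier_nonneg hκ hδ hC x) g2 2
  have g4 : 1 + θ x ≤ 2 * (1 + θ x ^ 2) := by nlinarith [sq_nonneg (θ x - 1)]
  calc energyDensity θ w (barrier κ δ C) (gradVec (barrier κ δ C)) x
      ≤ (θ x * (2 * δ) ^ 2 + (1 + θ x) * ((κ + δ * (2 + C)) ^ 2 * (1 + ‖x‖ ^ 2))) * w x := by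
        unfold energyDensity; gcongr
    _ ≤ ((1 + θ x) * ((2 * δ) ^ 2 * (1 + ‖x‖ ^ 2)) +
          (1 + θ x) * ((κ + δ * (2 + C)) ^ 2 * (1 + ‖x‖ ^ 2))) * w x := by
        gcongr
        · linarith
        · exact le_mul_of_one_le_right (by positivity) hN1
    _ = ((2 * δ) ^ 2 + (κ + δ * (2 + C)) ^ 2) * ((1 + ‖x‖ ^ 2) * (1 + θ x) * w x) := by ring
    _ ≤ ((2 * δ) ^ 2 + (κ + δ * (2 + C)) ^ 2) *
          ((1 + ‖x‖ ^ 2) * (2 * (1 + θ x ^ 2)) * w x) := by gcongr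
    _ = _ := by ring

end Barrier

/-! ### Extension of the integrated inequalities to energy limits. -/

section Limits

variable {d : ℕ} {O S : Set (Eu d)} {θ w : Eu d → ℝ} {A : Coefficients d} {K : ℝ}

/-- Integration by parts against nonnegative limits of test functions. -/
lemma IsEnergyLimit.integral_le_formDensity (hO : IsOpen O) (hdiv : DivergenceTheoremHolds O)
    (hw : IsWeight O w) (hθ : IsDegeneracyCoefficient O θ)
    (hθw : IntegrableOn (fun x => θ x * w x) O) (hK : 0 < K) (hA : A.Bounds O θ K)
    (hreg : A.Regular O S θ w) {g : Eu d → ℝ} (hg : ContDiff ℝ ∞ g)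
    (hgfe : FiniteEnergy O θ w g (gradVec g)) {κ : ℝ}
    (hκ : ∀ᵐ x ∂volume.restrict O, κ ≤ nonDivOp A w g x) {v : Eu d → ℝ} {η : Eu d → Eu d}
    (hv : IsEnergyLimit O θ w (nonnegTest O S) v η) :
    κ * (∫ x in O, v x * w x) ≤ ∫ x in O, formDensity A w g (gradVec g) v η x := by
  rw [← sub_nonpos]
  refine nonpos_of_forall_le_add (C := |κ| + K)
    (p := (∫ x in O, w x) + ∫ x in O, energyDensity θ w g (gradVec g) x) ?_
  intro t ht ε hε
  -- The inequality is known for `φ`; both sides are linear in the test function, and the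
  -- contribution of `v - φ` is estimated by Young's inequality with weight `t`.
  obtain ⟨φ, hφ, hf, hi⟩ := hv ε hε
  have hφfe := hφ.1.finiteEnergy hO hw hθ hθw
  have h1 := integral_le_of_nonDivOp_ge hO hdiv hw hθ hθw hK hA hreg hg hgfe hκ hφ
  have h2 := (abs_le.1 (hA.abs_integral_le hO hw hθ hK hgfe hf ht).1).1
  have e1 : ∫ x in O, formDensity A w g (gradVec g) v η x =
      (∫ x in O, formDensity A w g (gradVec g) φ (gradVec φ) x) +
      ∫ x in O, formDensity A w g (gradVec g) (v - φ) (η - gradVec φ) x := by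
    rw [← integral_add (hA.integrableOn_densities hO hw hθ hK hgfe hφfe).1
      (hA.integrableOn_densities hO hw hθ hK hgfe hf).1]
    congr 1
    ext x
    rw [← formDensity_add_right, add_sub_cancel, add_sub_cancel]
  have e2 : ∫ x in O, v x * w x = (∫ x in O, φ x * w x) + ∫ x in O, (v - φ) x * w x := by
    rw [← integral_add (hφfe.integrableOn_mul hO hw hθ) (hf.integrableOn_mul hO hw hθ)]
    congr 1
    ext x
    simp only [Pi.sub_apply]
    ring
  have h3 : |∫ x in O, (v - φ) x * w x| ≤ t * (∫ x in O, w x) +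
      1 / t * ∫ x in O, energyDensity θ w (v - φ) (η - gradVec φ) x := by
    rw [← integral_const_mul, ← integral_const_mul,
      ← integral_add (hw.integrableOn.const_mul t) (hf.integrable.const_mul (1 / t)),
      ← Real.norm_eq_abs]
    refine norm_integral_le_of_norm_le
      ((hw.integrableOn.const_mul t).add (hf.integrable.const_mul (1 / t))) ?_
    filter_upwards [ae_restrict_mem hO.measurableSet] with x hx
    have pw := hw.pos x hx
    have pθ := hθ.pos x hx
    have q := mul_le_weighted ht 1 |(v - φ) x|
    rw [sq_abs, one_mul, one_pow, mul_one] at q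
    have z1 : 0 ≤ 1 / t * (θ x * ‖(η - gradVec φ) x‖ ^ 2) := by positivity
    have z2 : 0 ≤ 1 / t * (θ x * (v - φ) x ^ 2) := by positivity
    have z3 : 0 ≤ 1 / t * (v - φ) x ^ 2 := by positivity
    rw [Real.norm_eq_abs, abs_mul, abs_of_pos pw]
    calc |(v - φ) x| * w x ≤ (t + 1 / t * (θ x * ‖(η - gradVec φ) x‖ ^ 2 +
          (1 + θ x) * (v - φ) x ^ 2)) * w x := by
          gcongr; linarith
      _ = _ := by unfold energyDensity; ring
  have hE : 0 ≤ ∫ x in O, energyDensity θ w g (gradVec g) x :=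
    setIntegral_nonneg hO.measurableSet fun x hx => energyDensity_nonneg hw hθ _ _ hx
  have hW : 0 ≤ ∫ x in O, w x :=
    setIntegral_nonneg hO.measurableSet fun x hx => (hw.pos x hx).le
  have h4 : 1 / t * (∫ x in O, energyDensity θ w (v - φ) (η - gradVec φ) x) ≤ 1 / t * ε := by
    gcongr
  have h5 : κ * (∫ x in O, (v - φ) x * w x) ≤ |κ| * (t * (∫ x in O, w x) + 1 / t * ε) := by
    refine (le_abs_self _).trans ?_
    rw [abs_mul]
    gcongr
    linarith
  have h6 : K * (t * (∫ x in O, energyDensity θ w g (gradVec g) x) +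
      1 / t * ∫ x in O, energyDensity θ w (v - φ) (η - gradVec φ) x) ≤
      K * (t * (∫ x in O, energyDensity θ w g (gradVec g) x) + 1 / t * ε) := by gcongr
  have z1 : 0 ≤ |κ| * (t * ∫ x in O, energyDensity θ w g (gradVec g) x) := by positivity
  have z2 : 0 ≤ K * (t * ∫ x in O, w x) := by positivity
  have z3 : 0 ≤ |κ| * ε := by positivity
  have z4 : 0 ≤ K * ε := by positivity
  rw [e1, e2]
  linarith

lemma gradVec_sq {v : Eu d → ℝ} (hv : ContDiff ℝ ∞ v) (x : Eu d) :
    gradVec (fun y => v y ^ 2) x = (2 * v x) • gradVec v x := by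
  ext i
  have dv : DifferentiableAt ℝ v x := hv.differentiable (by simp) x
  simp only [pow_two, gradVec_apply, pderiv_mul dv dv, PiLp.smul_apply, smul_eq_mul]
  ring

/-- The zeroth-order condition in integrated form: `∫ (2 v d^j v_{x_j} + c v²) w ≥ 0`. -/
lemma IsEnergyLimit.lower_integral_nonneg (hO : IsOpen O) (hdiv : DivergenceTheoremHolds O)
    (hw : IsWeight O w) (hθ : IsDegeneracyCoefficient O θ)
    (hθw : IntegrableOn (fun x => θ x * w x) O) (hK : 0 < K) (hA : A.Bounds O θ K)
    (hreg : A.Regular O S θ w) (hc : ∀ᵐ x ∂volume.restrict O, 0 ≤ A.cTilde w x)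
    {v : Eu d → ℝ} {η : Eu d → Eu d}
    (hvfe : FiniteEnergy O θ w v η) (hv : IsEnergyLimit O θ w (nonnegTest O S) v η) :
    0 ≤ ∫ x in O, lowerDensity A w v η v η x := by
  rw [← neg_nonpos]
  refine nonpos_of_forall_le_add (C := 2 * K) (p := ∫ x in O, energyDensity θ w v η x) ?_
  intro t ht ε hε
  obtain ⟨φ, hφ, hf, hi⟩ := hv ε hε
  have hφfe := hφ.1.finiteEnergy hO hw hθ hθw
  -- The constant 1 has zero gradient and `L 1 = c̃ ≥ 0`, and pairing it with `φ²` in the form gives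
  -- the integral of `2 φ d·Dφ + c φ²` against `w`. The square is taken of the test function `φ`,
  -- because `v²` is not known to have finite energy.
  obtain ⟨one, hone⟩ : ∃ one : Eu d → ℝ, one = fun _ => 1 := ⟨_, rfl⟩
  have h1x : ∀ x, one x = 1 := fun x => by rw [hone]
  have ho : ContDiff ℝ ∞ one := by rw [hone]; exact contDiff_const
  have hp1 : ∀ i, pderiv i one = fun _ => 0 := fun i => by ext x; simp [hone, pderiv]
  have hg1 : ∀ x, gradVec one x = 0 := fun x => by ext i; simp [hp1]
  have ofe : FiniteEnergy O θ w one (gradVec one) := by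
    refine .of_le hO hw hθ ho.continuous.aestronglyMeasurable
      (continuous_gradVec ho).aestronglyMeasurable
      (hw.integrableOn.add hθw) fun x hx => ?_
    simp only [energyDensity, hg1, h1x, Pi.add_apply, norm_zero]
    linarith
  have hop : ∀ᵐ x ∂volume.restrict O, 0 ≤ nonDivOp A w one x := by
    filter_upwards [hc] with x hx
    have : ∀ i j, pderiv j (pderiv i one) x = 0 := fun i j => by rw [hp1]; simp [pderiv]
    simp only [nonDivOp, this]
    simpa [hp1, h1x] using hx
  have hsq : (fun x => φ x ^ 2) ∈ nonnegTest O S := by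
    obtain ⟨C, hC, hCO, h0⟩ := hφ.1.2
    exact ⟨⟨hφ.1.1.pow 2, C, hC, hCO, fun x hx hxC => by simp [h0 x hx hxC]⟩,
      fun x => sq_nonneg _⟩
  have h1 := integral_le_of_nonDivOp_ge hO hdiv hw hθ hθw hK hA hreg ho ofe hop hsq
  have e0 : ∀ x, formDensity A w one (gradVec one) (fun x => φ x ^ 2)
      (gradVec fun x => φ x ^ 2) x = lowerDensity A w φ (gradVec φ) φ (gradVec φ) x := by
    intro x
    simp only [formDensity, lowerDensity, hg1, gradVec_sq hφ.1.1, sum_mul_mul_eq, inner_smul_right,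
      h1x, PiLp.zero_apply, mul_zero, zero_mul, Finset.sum_const_zero]
    ring
  simp only [e0, zero_mul] at h1
  have i1 := (hA.integrableOn_densities hO hw hθ hK hφfe hφfe).2
  have i2 := (hA.integrableOn_densities hO hw hθ hK hvfe hf).2
  have i3 := (hA.integrableOn_densities hO hw hθ hK hf hf).2
  have e1 : ∫ x in O, lowerDensity A w v η v η x =
      (∫ x in O, lowerDensity A w φ (gradVec φ) φ (gradVec φ) x) +
      (2 * (∫ x in O, lowerDensity A w v η (v - φ) (η - gradVec φ) x) -
        ∫ x in O, lowerDensity A w (v - φ) (η - gradVec φ) (v - φ) (η - gradVec φ) x) := by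
    rw [← integral_const_mul, ← integral_sub (i2.const_mul 2) i3]
    refine Eq.trans ?_ (integral_add i1 ((i2.const_mul 2).sub i3))
    exact integral_congr_ae (.of_forall fun x => lowerDensity_add_self v φ η (gradVec φ) x)
  have h2 := (abs_le.1 (hA.abs_integral_le hO hw hθ hK hvfe hf ht).2).1
  have h3 := (abs_le.1 (hA.abs_integral_le hO hw hθ hK hf hf one_pos).2).2
  have h4 : K * (1 / t * ∫ x in O, energyDensity θ w (v - φ) (η - gradVec φ) x) ≤
      K * (1 / t * ε) := by gcongr
  have h5 : K * (∫ x in O, energyDensity θ w (v - φ) (η - gradVec φ) x) ≤ K * ε := by gcongr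
  rw [e1]
  linarith

end Limits

/-! ### The comparison step, its iteration, and the maximum principle. -/

section MaximumPrinciple

variable {d : ℕ} {O S : Set (Eu d)} {θ w : Eu d → ℝ} {A : Coefficients d} {K : ℝ}

/-- The form evaluated at `(v, v)` controls the lower-order quadratic form up to `K² θ v² w`. -/
lemma Coefficients.Bounds.lowerDensity_sub_le (hO : IsOpen O) (hw : IsWeight O w)
    (hθ : IsDegeneracyCoefficient O θ) (hA : A.Bounds O θ K)
    (v : Eu d → ℝ) (η : Eu d → Eu d) : ∀ᵐ x ∂volume.restrict O,
      lowerDensity A w v η v η x - K ^ 2 * (θ x * v x ^ 2 * w x) ≤ formDensity A w v η v η x := by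
  filter_upwards [ae_restrict_mem hO.measurableSet, hA.a_lower, hA.e_bound, hA.b_bound]
    with x hx h1 h2 h3
  have pw := hw.pos x hx
  have pθ := hθ.pos x hx
  have a1 := h1 (η x)
  have be : v x * inner ℝ (A.e x) (η x) ≤ |v x| * (K * θ x * ‖η x‖) :=
    (le_abs_self _).trans (by rw [abs_mul]; gcongr; exact h2 _)
  have bb : v x * inner ℝ (A.b x) (η x) ≤ |v x| * (K * θ x * ‖η x‖) :=
    (le_abs_self _).trans (by rw [abs_mul]; gcongr; exact h3 _)
  -- The terms in `d` and `b` cost `2 K θ |v| |η|` together; this square absorbs them into the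
  -- elliptic term `θ |η|²`.
  have sq : 0 ≤ θ x * (‖η x‖ - K * |v x|) ^ 2 := by positivity
  have e : θ x * (‖η x‖ - K * |v x|) ^ 2 = θ x * ‖η x‖ ^ 2 - 2 * (|v x| * (K * θ x * ‖η x‖)) +
      K ^ 2 * (θ x * v x ^ 2) := by rw [← sq_abs (v x)]; ring
  rw [lowerDensity, formDensity, sum_mul_mul_eq, sum_mul_mul_eq']
  have : v x * inner ℝ (A.e x) (η x) + v x * inner ℝ (A.e x) (η x) + A.c x * v x * v x
      - K ^ 2 * (θ x * v x ^ 2) ≤ (∑ i, ∑ j, A.a x i j * η x i * η x j) +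
      v x * inner ℝ (A.e x) (η x) - v x * inner ℝ (A.b x) (η x) + A.c x * v x * v x := by
    linarith
  have := mul_le_mul_of_nonneg_right this pw.le
  linarith

lemma FiniteEnergy.integrableOn_theta_sq (hO : IsOpen O) (hw : IsWeight O w)
    (hθ : IsDegeneracyCoefficient O θ) {u : Eu d → ℝ} {g : Eu d → Eu d}
    (h : FiniteEnergy O θ w u g) : IntegrableOn (fun x => θ x * u x ^ 2 * w x) O ∧
      IntegrableOn (fun x => u x ^ 2 * w x) O := by
  constructor
  · refine Integrable.mono' h.integrable (((hθ.aesm hO).mul (h.meas.pow 2)).mul (hw.aesm hO)) ?_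
    filter_upwards [ae_restrict_mem hO.measurableSet] with x hx
    have pw := hw.pos x hx
    have pθ := hθ.pos x hx
    rw [Real.norm_of_nonneg (by positivity)]
    unfold energyDensity
    gcongr
    have : 0 ≤ θ x * ‖g x‖ ^ 2 := by positivity
    nlinarith [sq_nonneg (u x)]
  · refine Integrable.mono' h.integrable ((h.meas.pow 2).mul (hw.aesm hO)) ?_
    filter_upwards [ae_restrict_mem hO.measurableSet] with x hx
    have pw := hw.pos x hx
    have pθ := hθ.pos x hx
    rw [Real.norm_of_nonneg (by positivity)]
    unfold energyDensity
    gcongr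
    have : 0 ≤ θ x * ‖g x‖ ^ 2 := by positivity
    have : 0 ≤ θ x * u x ^ 2 := by positivity
    linarith

lemma l2Inner_le (hO : IsOpen O) (hw : IsWeight O w)
    {f v : Eu d → ℝ} (hf : MemL2 O w f) {F : ℝ}
    (hF : ∀ᵐ x ∂volume.restrict O, f x ≤ F) (hv : AEStronglyMeasurable v (volume.restrict O))
    (hv0 : ∀ x, 0 ≤ v x) (hvw : IntegrableOn (fun x => v x * w x) O)
    (hv2 : IntegrableOn (fun x => v x ^ 2 * w x) O) :
    l2Inner O w f v ≤ F * ∫ x in O, v x * w x := by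
  rw [l2Inner, ← integral_const_mul]
  have hi : IntegrableOn (fun x => f x * v x * w x) O := by
    refine Integrable.mono' (hf.2.add hv2) ((hf.1.mul hv).mul (hw.aesm hO)) ?_
    filter_upwards [ae_restrict_mem hO.measurableSet] with x hx
    have pw := hw.pos x hx
    rw [Real.norm_eq_abs, abs_mul, abs_of_pos pw]
    simp only [Pi.add_apply]
    rw [← add_mul]
    gcongr
    rw [abs_mul, ← sq_abs (f x), ← sq_abs (v x)]
    nlinarith [sq_nonneg (|f x| - |v x|), abs_nonneg (f x), abs_nonneg (v x), sq_nonneg |f x|,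
      sq_nonneg |v x|]
  refine integral_mono_ae hi (hvw.const_mul F) ?_
  filter_upwards [ae_restrict_mem hO.measurableSet, hF] with x hx hFx
  have := mul_le_mul_of_nonneg_right hFx (mul_nonneg (hv0 x) (hw.pos x hx).le)
  linarith

/-- The truncation of a function in `H¹(O, w)` whose positive part is a limit of test functions. -/
lemma exists_truncation (hO : IsOpen O) (hw : IsWeight O w)
    (hθ : IsDegeneracyCoefficient O θ) (hS : S ⊆ frontier O)
    (hint : IntegrableOn (fun x => (1 + ‖x‖ ^ 2) * (1 + θ x ^ 2) * w x) O) {u : Eu d → ℝ}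
    (hu : MemH1 O θ w u) (hub : (frontier O \ S).Nonempty → NonposOnBoundary O S θ w u) :
    ∃ (u' : Eu d → ℝ) (G : Eu d → Eu d), FiniteEnergy O θ w u' G ∧
      IsEnergyLimit O θ w {φ | IsTestFunction O S φ} u' G ∧
      (∀ x, max (u' x) 0 = max (u x) 0) ∧
      ∀ᵐ x ∂volume.restrict O, 0 < u x → G x = weakGrad O u x := by
  -- If `S` is not the whole boundary, `u⁺` is a limit of functions in `C₀^∞(O ∪ S)` by assumption
  -- and replaces `u`; otherwise `u` itself is such a limit.
  by_cases hne : (frontier O \ S).Nonempty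
  · have hp : MemH1Zero O S θ w (fun x => max (u x) 0) := hub hne
    refine ⟨_, _, hp.finiteEnergy hO hw hθ, hp.isEnergyLimit hO hw hθ, fun x => by simp, ?_⟩
    -- Truncation of `u` at the zero barrier identifies the weak gradient of `u⁺` with that of `u`
    -- where `u > 0`.
    have hz := finiteEnergy_barrier hO hw hθ hint le_rfl le_rfl (le_refl (0 : ℝ))
    have hb : barrier (d := d) 0 0 0 = fun _ => 0 := by ext x; simp [barrier]
    have hgb : gradVec (barrier (d := d) 0 0 0) = fun _ => 0 := by
      ext1 x; rw [gradVec_barrier]; simp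
    obtain ⟨h1, h2⟩ := IsEnergyLimit.posPart_sub hO hw hθ (MemH1Zero.finiteEnergy hO hw hθ hu)
      (MemH1Zero.isEnergyLimit hO hw hθ hu) (contDiff_barrier 0 0 0)
      (barrier_nonneg le_rfl le_rfl le_rfl) hz
    rw [hgb, hb] at h1 h2
    simp only [sub_zero] at h1 h2
    have h3 := (h2.hasWeakGradient hO hw hθ (fun φ hφ => hφ.1.1) h1).weakGrad_ae_eq hO
    filter_upwards [h3] with x hx hux
    rw [hx, if_pos hux]
  · have : S = frontier O :=
      hS.antisymm (Set.sdiff_eq_empty.1 (Set.not_nonempty_iff_eq_empty.1 hne))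
    subst this
    exact ⟨u, _, MemH1Zero.finiteEnergy hO hw hθ hu, MemH1Zero.isEnergyLimit hO hw hθ hu,
      fun _ => rfl, .of_forall fun _ _ => rfl⟩

/-- One comparison step: if `u` exceeds a barrier by a small amount at most, then it does not
exceed it. -/
lemma le_barrier_of_le_add (hO : IsOpen O) (hdiv : DivergenceTheoremHolds O)
    (hw : IsWeight O w) (hθ : IsDegeneracyCoefficient O θ)
    (hθw : IntegrableOn (fun x => θ x * w x) O) (hK : 0 < K) (hA : A.Bounds O θ K)
    (hreg : A.Regular O S θ w)
    (hint : IntegrableOn (fun x => (1 + ‖x‖ ^ 2) * (1 + θ x ^ 2) * w x) O)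
    {c₀ K₁ : ℝ} (hc₀ : 0 < c₀) (hc : ∀ᵐ x ∂volume.restrict O, c₀ ≤ A.cTilde w x)
    (hK₁ : 0 < K₁) (hgrowth : ∀ᵐ x ∂volume.restrict O,
      (A.a x).trace + ∑ i, A.bTilde w x i * x i ≤ K₁ * (1 + ‖x‖ ^ 2))
    {f u u' : Eu d → ℝ} {G : Eu d → Eu d} (hf : MemL2 O w f) {F : ℝ}
    (hF : ∀ᵐ x ∂volume.restrict O, f x ≤ F)
    (hsub : IsVariationalSubsolution O S θ w (bilinForm A O w) f u)
    (hfe : FiniteEnergy O θ w u' G)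
    (hlim : IsEnergyLimit O θ w {φ | IsTestFunction O S φ} u' G)
    (hmax : ∀ x, max (u' x) 0 = max (u x) 0)
    (hgrad : ∀ᵐ x ∂volume.restrict O, 0 < u x → G x = weakGrad O u x)
    {M k δ ε Θ : ℝ} (hM : 0 ≤ M) (hFM : F ≤ c₀ * M) (hk : 0 < k) (hδ : 0 ≤ δ)
    (hε : ∀ᵐ x ∂volume.restrict O, u x - barrier (M + k) δ (2 * K₁ / c₀) x ≤ ε)
    (hΘ : ∀ᵐ x ∂volume.restrict O, barrier (M + k) δ (2 * K₁ / c₀) x < u x → θ x ≤ Θ)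
    (hsmall : K ^ 2 * Θ * ε < c₀ * k) :
    ∀ᵐ x ∂volume.restrict O, u x ≤ barrier (M + k) δ (2 * K₁ / c₀) x := by
  have hC : 0 ≤ 2 * K₁ / c₀ := by positivity
  have hMk : 0 ≤ M + k := by positivity
  have hg := contDiff_barrier (d := d) (M + k) δ (2 * K₁ / c₀)
  have hg0 := barrier_nonneg (d := d) hMk hδ hC
  have hgfe := finiteEnergy_barrier hO hw hθ hint hMk hδ hC
  have hop := le_nonDivOp_barrier (w := w) hO hθ hA hc₀ hK₁ hMk hδ hc hgrowth
  set g := barrier (d := d) (M + k) δ (2 * K₁ / c₀) with hgdef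
  obtain ⟨vfe, vlim⟩ := hlim.posPart_sub hO hw hθ hfe hg hg0 hgfe
  set v : Eu d → ℝ := fun x => max (u' x - g x) 0 with hv
  set η : Eu d → Eu d := fun x => if g x < u' x then G x - gradVec g x else 0 with hη
  -- The barrier is nonnegative, so the set where it is exceeded depends on the positive part only.
  have hlt : ∀ x, g x < u' x ↔ g x < u x := by
    intro x
    have e := hmax x
    have h0 := hg0 x
    constructor
    · intro h
      rw [max_eq_left (h0.trans h.le)] at e
      rcases le_total (u x) 0 with h' | h'
      · rw [max_eq_right h'] at e; linarith
      · rw [max_eq_left h'] at e; linarith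
    · intro h
      rw [max_eq_left (h0.trans h.le)] at e
      rcases le_total (u' x) 0 with h' | h'
      · rw [max_eq_right h'] at e; linarith
      · rw [max_eq_left h'] at e; linarith
  have hveq : ∀ x, g x < u x → v x = u x - g x := by
    intro x hx
    have hx' := (hlt x).2 hx
    have e := hmax x
    rw [max_eq_left ((hg0 x).trans hx.le), max_eq_left ((hg0 x).trans hx'.le)] at e
    simp only [hv, e]
    exact max_eq_left (by linarith)
  have hveq0 : ∀ x, ¬ g x < u x → v x = 0 := by
    intro x hx
    exact max_eq_right (by have := not_lt.1 (mt (hlt x).1 hx); linarith)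
  have hv0 : ∀ x, 0 ≤ v x := fun x => le_max_right _ _
  have vtest : IsEnergyLimit O θ w {φ | IsTestFunction O S φ} v η := vlim.mono fun φ hφ => hφ.1
  have vmem : MemH1Zero O S θ w v := vtest.memH1Zero hO hw hθ vfe
  have vgrad := (vtest.hasWeakGradient hO hw hθ (fun φ hφ => hφ.1) vfe).weakGrad_ae_eq hO
  have vw := vfe.integrableOn_mul hO hw hθ
  obtain ⟨vθ2, v2⟩ := vfe.integrableOn_theta_sq hO hw hθ
  have h1 := hsub v vmem (.of_forall hv0)
  have h2 := l2Inner_le hO hw hf hF vfe.meas hv0 vw v2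
  have h3 := vlim.integral_le_formDensity hO hdiv hw hθ hθw hK hA hreg hg hgfe hop
  have h4 := vlim.lower_integral_nonneg hO hdiv hw hθ hθw hK hA hreg
    (hc.mono fun x hx => hc₀.le.trans hx) vfe
  have i1 := (hA.integrableOn_densities hO hw hθ hK hgfe vfe).1
  obtain ⟨i2, i3⟩ := hA.integrableOn_densities hO hw hθ hK vfe vfe
  -- Where `u > g` one has `u = g + v` and `Du = Dg + η`; elsewhere `v` and `η` are 0. Thus `𝔞(u, v)
  -- = 𝔞(g, v) + 𝔞(v, v)`.
  have e1 : bilinForm A O w u v = (∫ x in O, formDensity A w g (gradVec g) v η x) +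
      ∫ x in O, formDensity A w v η v η x := by
    rw [← integral_add i1 i2]
    refine integral_congr_ae ?_
    filter_upwards [vgrad, hgrad] with x hx hGx
    rw [hx]
    by_cases hgu : g x < u x
    · have hη' : weakGrad O u x = gradVec g x + η x := by
        rw [← hGx ((hg0 x).trans_lt hgu)]
        simp only [hη, if_pos ((hlt x).2 hgu), add_sub_cancel]
      have hu' : u x = g x + v x := by rw [hveq x hgu]; ring
      rw [hη', hu']
      simp only [formDensity, PiLp.add_apply, mul_add, add_mul, Finset.sum_add_distrib]
      ring
    · have hη' : η x = 0 := by simp only [hη, if_neg (mt (hlt x).1 hgu)]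
      simp [formDensity, hη', hveq0 x hgu]
  have h5 : (∫ x in O, lowerDensity A w v η v η x) - K ^ 2 * (∫ x in O, θ x * v x ^ 2 * w x) ≤
      ∫ x in O, formDensity A w v η v η x := by
    rw [← integral_const_mul, ← integral_sub i3 (vθ2.const_mul _)]
    exact integral_mono_ae (i3.sub (vθ2.const_mul _)) i2
      (hA.lowerDensity_sub_le hO hw hθ v η)
  -- One factor `v` is bounded by `ε`, and `θ` by `Θ` where `v ≠ 0`, so the quadratic error becomes
  -- comparable with the linear gain `∫ v w`.
  have h6 : ∫ x in O, θ x * v x ^ 2 * w x ≤ Θ * ε * ∫ x in O, v x * w x := by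
    rw [← integral_const_mul]
    refine integral_mono_ae vθ2 (vw.const_mul _) ?_
    filter_upwards [ae_restrict_mem hO.measurableSet, hε, hΘ] with x hx hεx hΘx
    have pw := hw.pos x hx
    have pθ := hθ.pos x hx
    by_cases hgu : g x < u x
    · have b1 : v x ≤ ε := by rw [hveq x hgu]; exact hεx
      have b2 := hΘx hgu
      have b0 := hv0 x
      calc θ x * v x ^ 2 * w x = θ x * v x * (v x * w x) := by ring
        _ ≤ Θ * ε * (v x * w x) := by
          have : 0 ≤ Θ := pθ.le.trans b2
          gcongr
    · simp [hveq0 x hgu]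
  have hI : 0 ≤ ∫ x in O, v x * w x :=
    setIntegral_nonneg hO.measurableSet fun x hx => mul_nonneg (hv0 x) (hw.pos x hx).le
  set I := ∫ x in O, v x * w x
  -- All estimates together read `c₀ (M + k) I - K² Θ ε I ≤ F I ≤ c₀ M I`, that is `c₀ k I ≤ K² Θ ε
  -- I`, which the smallness condition excludes for `I > 0`.
  have hI0 : I = 0 := by
    have b1 : F * I ≤ c₀ * M * I := mul_le_mul_of_nonneg_right hFM hI
    have b2 : K ^ 2 * (∫ x in O, θ x * v x ^ 2 * w x) ≤ K ^ 2 * (Θ * ε * I) := by gcongr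
    by_contra hne
    have pI : 0 < I := lt_of_le_of_ne hI (Ne.symm hne)
    have b3 := mul_lt_mul_of_pos_right hsmall pI
    linarith
  have hz := (setIntegral_eq_zero_iff_of_nonneg_ae (by
    filter_upwards [ae_restrict_mem hO.measurableSet] with x hx
    exact mul_nonneg (hv0 x) (hw.pos x hx).le) vw).1 hI0
  filter_upwards [hz, ae_restrict_mem hO.measurableSet] with x hx hxO
  have hv' : v x = 0 := (mul_eq_zero.1 hx).resolve_right (hw.pos x hxO).ne'
  by_contra h
  have := hveq x (not_le.1 h)
  linarith [not_le.1 h]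

lemma barrier_add (M k δ C : ℝ) (x : Eu d) : barrier (M + k) δ C x = k + barrier M δ C x := by
  unfold barrier; ring

/-- The maximum principle with an explicit real upper bound `F` of the source function. -/
theorem ae_le_max_of_isVariationalSubsolution (hO : IsOpen O) (hdiv : DivergenceTheoremHolds O)
    (hS : S ⊆ frontier O)
    (hw : IsWeight O w) (hθ : IsDegeneracyCoefficient O θ)
    (hθw : IntegrableOn (fun x => θ x * w x) O) (hK : 0 < K) (hA : A.Bounds O θ K)
    (hreg : A.Regular O S θ w)
    (hint : IntegrableOn (fun x => (1 + ‖x‖ ^ 2) * (1 + θ x ^ 2) * w x) O)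
    {c₀ K₁ : ℝ} (hc₀ : 0 < c₀) (hc : ∀ᵐ x ∂volume.restrict O, c₀ ≤ A.cTilde w x)
    (hK₁ : 0 < K₁) (hgrowth : ∀ᵐ x ∂volume.restrict O,
      (A.a x).trace + ∑ i, A.bTilde w x i * x i ≤ K₁ * (1 + ‖x‖ ^ 2))
    {f u : Eu d → ℝ} (hf : MemL2 O w f) {F : ℝ}
    (hF : ∀ᵐ x ∂volume.restrict O, f x ≤ F)
    (hu : MemH1 O θ w u) (hsub : IsVariationalSubsolution O S θ w (bilinForm A O w) f u)
    (hub : (frontier O \ S).Nonempty → NonposOnBoundary O S θ w u)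
    {U : ℝ} (hU : ∀ᵐ x ∂volume.restrict O, u x ≤ U) :
    ∀ᵐ x ∂volume.restrict O, u x ≤ max 0 (1 / c₀ * F) := by
  obtain ⟨u', G, hfe, hlim, hmax, hgrad⟩ := exists_truncation hO hw hθ hS hint hu hub
  set M := max 0 (1 / c₀ * F) with hMdef
  have hM : 0 ≤ M := le_max_left _ _
  have hFM : F ≤ c₀ * M := by
    have : 1 / c₀ * F ≤ M := le_max_right _ _
    calc F = c₀ * (1 / c₀ * F) := by field_simp
      _ ≤ c₀ * M := by gcongr
  set C := 2 * K₁ / c₀ with hCdef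
  have hC : 0 ≤ C := by positivity
  have main : ∀ δ > 0, ∀ᵐ x ∂volume.restrict O, u x ≤ barrier M δ C x := by
    intro δ hδ
    -- Where `u` exceeds the barrier, `δ log (1 + |x|²) < U`, so `|x| ≤ 1 + |x|² < exp (U / δ)`. On
    -- the closure of `O` within that ball `θ` is bounded by continuity.
    have hcomp : IsCompact (closure O ∩ Metric.closedBall (0 : Eu d) (Real.exp (U / δ))) :=
      (isCompact_closedBall _ _).inter_left isClosed_closure
    obtain ⟨Θ, hΘ⟩ := hcomp.exists_bound_of_continuousOn
      (hθ.continuousOn.mono Set.inter_subset_left)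
    have hΘ' : ∀ k > 0, ∀ᵐ x ∂volume.restrict O, barrier (M + k) δ C x < u x → θ x ≤ max Θ 0 := by
      intro k hk
      filter_upwards [ae_restrict_mem hO.measurableSet, hU] with x hx hUx hlt
      refine le_max_of_le_left ((le_abs_self _).trans (hΘ x ⟨subset_closure hx, ?_⟩))
      rw [mem_closedBall_zero_iff]
      have h1 : δ * Real.log (1 + ‖x‖ ^ 2) < U := by
        have h2 : barrier (M + k) δ C x = M + k + δ * Real.log (1 + ‖x‖ ^ 2) + δ * C := by
          unfold barrier; ring
        have h3 : 0 ≤ δ * C := by positivity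
        linarith
      have h4 : Real.log (1 + ‖x‖ ^ 2) < U / δ := by rw [lt_div_iff₀ hδ]; linarith
      have h5 := (Real.log_lt_iff_lt_exp (one_add_norm_sq_pos x)).1 h4
      nlinarith [sq_nonneg (‖x‖ - 1), norm_nonneg x]
    set Θ' := max Θ 0
    have hΘ0 : 0 ≤ Θ' := le_max_right _ _
    -- This gives `K² Θ' r < c₀`, with the `+ 1` covering `Θ' = 0`. As `r` does not depend on the
    -- level `k`, every step gains the same factor `1 + r`.
    set r := c₀ / (K ^ 2 * Θ' + 1) with hr
    have hr0 : 0 < r := by positivity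
    have hrs : K ^ 2 * Θ' * r < c₀ := by
      rw [hr, mul_div_assoc', div_lt_iff₀ (by positivity)]
      nlinarith
    -- The comparison is applied at level `k` with `ε = r k`, since the previous level is `k + r k`.
    -- Starting from `max U 1` keeps every level positive.
    have step : ∀ n : ℕ, ∀ᵐ x ∂volume.restrict O,
        u x ≤ max U 1 / (1 + r) ^ n + barrier M δ C x := by
      intro n
      induction n with
      | zero =>
        filter_upwards [hU] with x hx
        have := barrier_nonneg hM hδ.le hC x
        have h2 := le_max_left U 1
        rw [pow_zero, div_one]
        linarith
      | succ n ih =>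
        set k := max U 1 / (1 + r) ^ (n + 1) with hk
        have hk0 : 0 < k := by positivity
        have hkn : max U 1 / (1 + r) ^ n = k + r * k := by
          rw [hk, pow_succ]; field_simp
        have := le_barrier_of_le_add hO hdiv hw hθ hθw hK hA hreg hint hc₀ hc hK₁ hgrowth hf hF
          hsub hfe hlim hmax hgrad hM hFM hk0 hδ.le (ε := r * k) (Θ := Θ') ?_ (hΘ' k hk0) ?_
        · filter_upwards [this] with x hx
          rwa [barrier_add] at hx
        · filter_upwards [ih] with x hx
          rw [hkn] at hx
          rw [barrier_add]
          linarith
        · rw [← mul_assoc]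
          exact mul_lt_mul_of_pos_right hrs hk0
    filter_upwards [ae_all_iff.2 step] with x hx
    have hlim0 : Tendsto (fun n : ℕ => max U 1 / (1 + r) ^ n + barrier M δ C x) atTop
        (𝓝 (0 + barrier M δ C x)) :=
      (tendsto_const_nhds.div_atTop (tendsto_pow_atTop_atTop_of_one_lt (by linarith))).add_const _
    rw [zero_add] at hlim0
    exact ge_of_tendsto hlim0 (.of_forall hx)
  -- A countable sequence of values of `δ` keeps the union of exceptional sets null.
  have hall := ae_all_iff.2 fun n : ℕ => main (1 / ((n : ℝ) + 1)) (by positivity)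
  filter_upwards [hall] with x hx
  have hlim0 : Tendsto (fun n : ℕ => barrier M (1 / ((n : ℝ) + 1)) C x) atTop
      (𝓝 (M + 0 * (Real.log (1 + ‖x‖ ^ 2) + C))) :=
    (tendsto_one_div_add_atTop_nhds_zero_nat.mul_const _).const_add M
  rw [zero_mul, add_zero] at hlim0
  exact ge_of_tendsto hlim0 (.of_forall hx)

lemma ae_le_essSupOn (O : Set (Eu d)) (u : Eu d → ℝ) :
    ∀ᵐ x ∂volume.restrict O, (u x : EReal) ≤ essSupOn O u := ae_le_essSup

lemma essSupOn_le {u : Eu d → ℝ} {B : EReal}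
    (h : ∀ᵐ x ∂volume.restrict O, (u x : EReal) ≤ B) : essSupOn O u ≤ B :=
  essSup_le_of_ae_le B h

end MaximumPrinciple

theorem mainTheorem9 {d : ℕ} (hd : 1 ≤ d)
    (O S : Set (Eu d)) (hO : IsOpen O) (hdiv : DivergenceTheoremHolds O)
    (hS : S ⊆ frontier O)
    (θ w : Eu d → ℝ) (hw : IsWeight O w) (hθ : IsDegeneracyCoefficient O θ)
    (hθw : IntegrableOn (fun x => θ x * w x) O)
    (A : Coefficients d) (K : ℝ) (hK : 0 < K) (hA : A.Bounds O θ K) (hreg : A.Regular O S θ w)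
    (hint : IntegrableOn (fun x => (1 + ‖x‖ ^ 2) * (1 + θ x ^ 2) * w x) O)
    (c₀ : ℝ) (hc₀ : 0 < c₀) (hc : ∀ᵐ x ∂volume.restrict O, c₀ ≤ A.cTilde w x)
    (K₁ : ℝ) (hK₁ : 0 < K₁)
    (hgrowth : ∀ᵐ x ∂volume.restrict O,
      (A.a x).trace + ∑ i, A.bTilde w x i * x i ≤ K₁ * (1 + ‖x‖ ^ 2)) :
    (∀ f u : Eu d → ℝ, MemL2 O w f → essSupOn O f < ⊤ →
      MemH1 O θ w u →
      IsVariationalSubsolution O S θ w (bilinForm A O w) f u →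
      ((frontier O \ S).Nonempty → NonposOnBoundary O S θ w u) →
      essSupOn O u < ⊤ →
      essSupOn O u ≤ max 0 (((1 / c₀ : ℝ) : EReal) * essSupOn O f)) ∧
    WeakMaximumPrincipleProperty O S θ w (bilinForm A O w)
      {u | MemH1 O θ w u ∧ essSupOn O u < ⊤} := by
  -- If the essential supremum is `⊥`, `toReal` returns 0, which is still an upper bound.
  have bdd : ∀ u : Eu d → ℝ, essSupOn O u < ⊤ →
      ∀ᵐ x ∂volume.restrict O, u x ≤ (essSupOn O u).toReal := by
    intro u hu
    filter_upwards [ae_le_essSupOn O u] with x hx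
    exact_mod_cast hx.trans (EReal.le_coe_toReal hu.ne)
  refine ⟨?_, ?_⟩
  · intro f u hf hf' hu hsub hub hu'
    have key := ae_le_max_of_isVariationalSubsolution hO hdiv hS hw hθ hθw hK hA hreg hint hc₀ hc
      hK₁ hgrowth hf (bdd f hf') hu hsub hub (bdd u hu')
    refine essSupOn_le ?_
    filter_upwards [key, ae_le_essSupOn O f] with x hx hfx
    -- The value `⊥` is excluded only at a given point `x`; when `O` is empty there is no such point
    -- and the bound is vacuous.
    have hbot : essSupOn O f ≠ ⊥ := ((EReal.bot_lt_coe (f x)).trans_le hfx).ne'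
    rw [← EReal.coe_toReal hf'.ne hbot, ← EReal.coe_mul, ← EReal.coe_zero]
    exact (EReal.coe_le_coe_iff.2 hx).trans_eq (EReal.coe_strictMono.monotone.map_max)
  · rintro u ⟨hu, hu'⟩ hsub hub
    have hsub' : IsVariationalSubsolution O S θ w (bilinForm A O w) (fun _ => 0) u := by
      intro v hv hv0
      simpa [l2Inner] using hsub v hv hv0
    have hf : MemL2 O w fun _ => 0 := ⟨aestronglyMeasurable_const, by simp⟩
    have key := ae_le_max_of_isVariationalSubsolution hO hdiv hS hw hθ hθw hK hA hreg hint hc₀ hc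
      hK₁ hgrowth hf (F := 0) (.of_forall fun _ => le_rfl) hu hsub' (fun _ => hub) (bdd u hu')
    simpa using key
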